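/- **Setting.** Let $K\ge 2$ and let $\nu=(\nu_k)_{k\in[K]}$ be probability distributions on $\mathbb R$ with means $\mu=(\mu_k)_{k\in[K]}$, each $1$-sub-Gaussian: $\mathbb E_{X\sim\nu_k}[e^{\lambda(X-\mu_k)}]\le e^{\lambda^2/2}$ for all $\lambda\in\mathbb R$. Put $\mu_\star=\max_k\mu_k$, let $C_\mu=|\{\mu_k: k\in[K]\}|$, let $0=\Delta_1<\Delta_2<\dots<\Delta_{C_\mu}$ be the distinct values of $\mu_\star-\mu_k$, let $\mathcal C_\mu(i)=\{k:\mu_\star-\mu_k=\Delta_i\}$ and $i^\star(\mu)=\{k:\mu_k=\mu_\star\}$. Let $\epsilon_0>0$. **Algorithm.** EB-TC$_{\epsilon_0}$ with fixed proportion $\beta=1/2$ pulls every arm once in rounds $1,\dots,K$. In round $n>K$ let $N_{n,i}$ and $\mu_{n,i}$ be the number of pulls and the empirical mean of arm $i$ over rounds $1,\dots,n-1$. The leader is $B_n=\hat\imath_n\in\arg\max_i\mu_{n,i}$, the challenger is $C_n\in\arg\min_{i\neq B_n}\frac{\mu_{n,B_n}-\mu_{n,i}+\epsilon_0}{\sqrt{1/N_{n,B_n}+1/N_{n,i}}}$,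 and ties are broken arbitrarily, on the basis of the past and possibly of additional randomization. Let $T_{n}(i,j)$ be the number of rounds $t$ with $K<t<n$ and $(B_t,C_t)=(i,j)$, and $N^i_{n,j}$ the number of those in which $j$ was pulled. The algorithm pulls $C_n$ if $N^{B_n}_{n,C_n}\le\frac12T_{n+1}(B_n,C_n)$, and $B_n$ otherwise; given the past, the reward is drawn from the distribution of the pulled arm. It recommends $\hat\imath_n$ at time $n$. **Complexities.** Let $p(x)=x-\log x$, $c_i=\frac{2}{\Delta_i}-\frac1{\epsilon_0}$ and $c_{i,j}=2\,\frac{\Delta_j/\epsilon_0+1}{\Delta_i-\Delta_j}+\frac{3}{\epsilon_0}$. For $i\in[C_\mu-1]$ let $H_i(\mu,\epsilon_0)=\min_{j\in[i]}\max\{\bar H_{i,j},\tilde H_{i,j}\}$, where $$\bar H_{i,j}=|i^\star(\mu)|\max\Big\{\tfrac{\sqrt2}{\Delta_{j+1}},c_{i+1,j}\Big\}^2+\max\{c_{j+1},c_{i+1,j}\}^2\Big(\sum_{k=2}^{j}|\mathcal C_\mu(k)|+\sum_{k=i+1}^{C_\mu}|\mathcal C_\mu(k)|\Big)+\sum_{k=j+1}^{i}|\mathcal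 C_\mu(k)|\max\Big\{c_{j+1},c_{i+1,j},\tfrac{\sqrt2}{\Delta_k}\Big\}^2,$$ $$\tilde H_{i,j}=\frac{2|i^\star(\mu)|}{\Delta_{j+1}^2}+\max\Big\{c_{j+1},\tfrac1{\epsilon_0}\Big\}^2\sum_{k=2}^{j}|\mathcal C_\mu(k)|+\frac{2\sum_{k=1}^{j}|\mathcal C_\mu(k)|}{(\Delta_{i+1}-\Delta_j)^2}+\sum_{k=j+1}^{C_\mu}|\mathcal C_\mu(k)|\max\Big\{c_{j+1},\tfrac1{\epsilon_0},\tfrac{\sqrt2}{\Delta_k}\Big\}^2.$$ **Claim.** (a) If $C_\mu\ge2$, then $H_1(\mu,\epsilon_0)=K\big(\frac2{\Delta_2}+\frac3{\epsilon_0}\big)^2$. For $2\le i\le C_\mu-1$, $\;2K\Delta_{i+1}^{-2}\le H_i(\mu,\epsilon_0)\le\frac32K\min_{j\in[i]}\max\{\frac{2}{\Delta_{j+1}},c_{i+1,j}\}^2$. (b) For every integer $n>5K^2/2$, with $x_i=\frac{n-5K^2/2}{8H_i(\mu,\epsilon_0)}$, $$\mathbb E_\nu[\mu_\star-\mu_{\hat\imath_n}]\le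 K^2e^2(2+\log n)^2\sum_{i\in[C_\mu-1]}(\Delta_{i+1}-\Delta_i)\exp\big(-p(\max\{1,x_i\})\big).$$ (c) In particular, for every integer $n>5K^2/2$ such that $n\ge 5K^2/2+8H_i(\mu,\epsilon_0)$ for all $i\in[C_\mu-1]$, $$\mathbb E_\nu[\mu_\star-\mu_{\hat\imath_n}]\le K^2e^2(2+\log n)^2\sum_{i\in[C_\mu-1]}(\Delta_{i+1}-\Delta_i)\exp\Big(-p\Big(\frac{n-5K^2/2}{8H_i(\mu,\epsilon_0)}\Big)\Big).$$ -/

import Mathlib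

open MeasureTheory ProbabilityTheory

noncomputable section

namespace EBTC

/-! ### Bandit instances: means, gaps, classes of arms -/

/-- The mean of each arm of the instance `ν`. -/
def armMean {K : ℕ} (ν : Fin K → Measure ℝ) (k : Fin K) : ℝ := ∫ x, x ∂(ν k)

/-- A probability distribution on `ℝ` is 1-sub-Gaussian when its centred version has a moment
generating function that is finite and bounded by `exp (t ^ 2 / 2)` everywhere. -/
def IsOneSubGaussian (ρ : Measure ℝ) : Prop :=
  HasSubgaussianMGF (fun x : ℝ => x - ∫ y, y ∂ρ) 1 ρ

/-- The largest mean `μ⋆`. -/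
def bestMean {K : ℕ} (μ : Fin K → ℝ) : ℝ := ⨆ k, μ k

/-- `C_μ`, the number of distinct arm means. -/
def numClasses {K : ℕ} (μ : Fin K → ℝ) : ℕ := (Finset.univ.image μ).card

/-- The finite set of values taken by the gaps `μ⋆ - μ_k`. -/
def gapValues {K : ℕ} (μ : Fin K → ℝ) : Finset ℝ :=
  Finset.univ.image fun k => bestMean μ - μ k

/-- `Δ_i`, the `i`-th smallest gap value (`i = 1, …, C_μ`), so that
`0 = Δ_1 < Δ_2 < ⋯ < Δ_{C_μ}`. The value is irrelevant for `i` outside this range. -/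
def gap {K : ℕ} (μ : Fin K → ℝ) (i : ℕ) : ℝ :=
  ((gapValues μ).sort (· ≤ ·)).getD (i - 1) 0

/-- The number of arms in the class `𝒞_μ(i)` of arms whose gap is `Δ_i`. -/
def classCard {K : ℕ} (μ : Fin K → ℝ) (i : ℕ) : ℕ :=
  (Finset.univ.filter fun k => bestMean μ - μ k = gap μ i).card

/-- The number `|i⋆(μ)|` of arms with the largest mean. -/
def numBest {K : ℕ} (μ : Fin K → ℝ) : ℕ :=
  (Finset.univ.filter fun k => μ k = bestMean μ).card

/-! ### Complexities -/

/-- `C_i(ε₀) = 2 / Δ_i - 1 / ε₀`. -/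
def cOne {K : ℕ} (μ : Fin K → ℝ) (ε₀ : ℝ) (i : ℕ) : ℝ := 2 / gap μ i - 1 / ε₀

/-- `C_{i,j}(ε₀) = 2 (Δ_j / ε₀ + 1) / (Δ_i - Δ_j) + 3 / ε₀`. -/
def cTwo {K : ℕ} (μ : Fin K → ℝ) (ε₀ : ℝ) (i j : ℕ) : ℝ :=
  2 * ((gap μ j / ε₀ + 1) / (gap μ i - gap μ j)) + 3 / ε₀

/-- The complexity `H̄_{i,j}(μ, ε₀)`. -/
def hBar {K : ℕ} (μ : Fin K → ℝ) (ε₀ : ℝ) (i j : ℕ) : ℝ :=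
  numBest μ * (max (√2 / gap μ (j + 1)) (cTwo μ ε₀ (i + 1) j)) ^ 2
  + (max (cOne μ ε₀ (j + 1)) (cTwo μ ε₀ (i + 1) j)) ^ 2
      * ((∑ k ∈ Finset.Icc 2 j, (classCard μ k : ℝ))
        + ∑ k ∈ Finset.Icc (i + 1) (numClasses μ), (classCard μ k : ℝ))
  + ∑ k ∈ Finset.Icc (j + 1) i, (classCard μ k : ℝ)
      * (max (max (cOne μ ε₀ (j + 1)) (cTwo μ ε₀ (i + 1) j)) (√2 / gap μ k)) ^ 2

/-- The complexity `H̃_{i,j}(μ, ε₀)`. -/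
def hTilde {K : ℕ} (μ : Fin K → ℝ) (ε₀ : ℝ) (i j : ℕ) : ℝ :=
  2 * numBest μ / gap μ (j + 1) ^ 2
  + (max (cOne μ ε₀ (j + 1)) (1 / ε₀)) ^ 2 * ∑ k ∈ Finset.Icc 2 j, (classCard μ k : ℝ)
  + 2 * (∑ k ∈ Finset.Icc 1 j, (classCard μ k : ℝ)) / (gap μ (i + 1) - gap μ j) ^ 2
  + ∑ k ∈ Finset.Icc (j + 1) (numClasses μ), (classCard μ k : ℝ)
      * (max (max (cOne μ ε₀ (j + 1)) (1 / ε₀)) (√2 / gap μ k)) ^ 2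

/-- `H_i(μ, ε₀) = min_{j ∈ [i]} max {H̄_{i,j}(μ, ε₀), H̃_{i,j}(μ, ε₀)}` for `1 ≤ i < C_μ`. -/
def complexity {K : ℕ} (μ : Fin K → ℝ) (ε₀ : ℝ) (i : ℕ) : ℝ :=
  ⨅ j : Finset.Icc 1 i, max (hBar μ ε₀ i j) (hTilde μ ε₀ i j)

/-- `p(x) = x - log x`. -/
def pFun (x : ℝ) : ℝ := x - Real.log x

/-! ### The algorithm, along one trajectory

Rounds are numbered `1, 2, 3, …`. `I t` is the arm pulled and `X t` the reward seen in round `t`;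
`B t` and `C t` are the leader and the challenger, defined in the rounds `t > K`. -/

/-- `N_{n,i}`: number of pulls of arm `i` before time `n`. -/
def pulls {K : ℕ} (I : ℕ → Fin K) (n : ℕ) (i : Fin K) : ℕ :=
  ((Finset.Ico 1 n).filter fun t => I t = i).card

/-- `μ_{n,i}`: empirical mean of arm `i` before time `n`. -/
def empMean {K : ℕ} (I : ℕ → Fin K) (X : ℕ → ℝ) (n : ℕ) (i : Fin K) : ℝ :=
  (∑ t ∈ (Finset.Ico 1 n).filter (fun t => I t = i), X t) / pulls I n i

/-- `T_n(i,j)`: number of rounds before time `n` with leader `i` and challenger `j`. -/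
def pairCount {K : ℕ} (B C : ℕ → Fin K) (n : ℕ) (i j : Fin K) : ℕ :=
  ((Finset.Ico (K + 1) n).filter fun t => B t = i ∧ C t = j).card

/-- Number of rounds before time `n` with leader `i` and challenger `j` in which the challenger
`j` was pulled, written `N^i_{n,j}`. -/
def challengerPulls {K : ℕ} (I B C : ℕ → Fin K) (n : ℕ) (i j : Fin K) : ℕ :=
  ((Finset.Ico (K + 1) n).filter fun t => B t = i ∧ C t = j ∧ I t = j).card

/-- Empirical transportation cost with slack `ε₀` at time `n`, of leader `i` and challenger `j`. -/
def transportCost {K : ℕ} (I : ℕ → Fin K) (X : ℕ → ℝ) (ε₀ : ℝ) (n : ℕ) (i j : Fin K) : ℝ :=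
  (empMean I X n i - empMean I X n j + ε₀) / √(1 / (pulls I n i : ℝ) + 1 / (pulls I n j : ℝ))

/-- The trajectory follows the EB-TC algorithm with slack `ε₀` and fixed proportion `β`, for some
way of breaking ties. The arm recommended at time `n > K` is the leader `B n`. -/
structure IsRun {K : ℕ} (ε₀ β : ℝ) (I : ℕ → Fin K) (X : ℕ → ℝ) (B C : ℕ → Fin K) : Prop where
  /-- every arm is pulled exactly once during the first `K` rounds -/
  init : ∀ i, pulls I (K + 1) i = 1
  /-- the leader has the largest empirical mean -/
  leader : ∀ n, K < n → ∀ i, empMean I X n i ≤ empMean I X n (B n)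
  /-- the challenger differs from the leader -/
  challenger_ne : ∀ n, K < n → C n ≠ B n
  /-- the challenger minimizes the transportation cost -/
  challenger : ∀ n, K < n → ∀ i, i ≠ B n →
    transportCost I X ε₀ n (B n) (C n) ≤ transportCost I X ε₀ n (B n) i
  /-- tracking, separately for each pair of a leader and a challenger -/
  tracking : ∀ n, K < n → I n =
    if (challengerPulls I B C n (B n) (C n) : ℝ) ≤ (1 - β) * pairCount B C (n + 1) (B n) (C n)
    then C n else B n

/-! ### Interaction with the bandit -/

/-- `I`, `X`, `B`, `C` are the random pulled arms, rewards, leaders and challengers of EB-TC with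
slack `ε₀` and fixed proportion `β` on the bandit `ν`. The σ-algebra `𝓕 t` is the information
available at the end of round `t`; it may hold, besides the past arms and rewards, any randomness
used to break ties. -/
structure IsEBTC {K : ℕ} {Ω : Type*} [mΩ : MeasurableSpace Ω] (P : Measure Ω)
    (ν : Fin K → Measure ℝ) (ε₀ β : ℝ) (𝓕 : Filtration ℕ mΩ)
    (I : ℕ → Ω → Fin K) (X : ℕ → Ω → ℝ) (B C : ℕ → Ω → Fin K) : Prop where
  /-- choices of a round depend on the information available before it -/
  measurable_arm : ∀ t, Measurable[𝓕 t] (I (t + 1))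
  measurable_leader : ∀ t, Measurable[𝓕 t] (B (t + 1))
  measurable_challenger : ∀ t, Measurable[𝓕 t] (C (t + 1))
  /-- the reward is seen at the end of the round -/
  measurable_reward : ∀ t, Measurable[𝓕 (t + 1)] (X (t + 1))
  /-- given the past and the choice of the arm, the reward is drawn from that arm -/
  reward_law : ∀ t, ∀ s : Set ℝ, MeasurableSet s →
    P⟦X (t + 1) ⁻¹' s | 𝓕 t⟧ =ᵐ[P] fun ω => (ν (I (t + 1) ω)).real s
  /-- almost every trajectory follows the algorithm -/
  run : ∀ᵐ ω ∂P, IsRun ε₀ β (fun t => I t ω) (fun t => X t ω) (fun t => B t ω) (fun t => C t ω)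

end EBTC

end

/-! Fix a level x > 1 and call a time accurate when, for every pair of arms, the squared errors of
the two empirical means, weighted by the pull counts, add up to less than 2x. Deterministic half: by
Cauchy–Schwarz, accuracy bounds the error of a difference of empirical means by √(2x)·√(1/N_i +
1/N_k), which is the normalisation of the transportation cost. If leader and challenger are both
well sampled, the slack ε₀ makes the cost of the challenger large, and by minimality every other arm
is costly too. This is incompatible with a rarely pulled bad arm (`IsRun.undersampled_of_bad_arm`)
and with a suboptimal leader, against which a best arm is cheap (`IsRun.undersampled_of_leader`). So
one arm of the pair is undersampled, and since tracking gives each arm about half of the rounds of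
its pair, this lasts for at most about twice the sum of the thresholds (`IsRun.lt_of_undersampled`).
Suppose the arm recommended at time n has gap at least Δ_{i+1}, and let j attain the minimum H_i. If
that arm has few pulls, the count contradicts H̄_{i,j}. If it has many, its leading at time n forces
all arms of gap at most Δ_j to have few pulls, and the count contradicts H̃_{i,j}
(`IsRun.regret_lt_gap`). Probabilistic half: products of exponential supermartingales of two arms,
mixed over independent Gaussian parameters, obey a Ville inequality. On slices where the counts are
known up to a factor e it costs e²·x·exp(-x) = e²·exp(-p(x)) (`IsEBTC.measure_deviation_le`). A
union over pairs of arms and pairs of slices gives the prefactor (`IsEBTC.measure_not_accurate_le`).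
Taking x with 8xH_i + 5K²/2 = n and weighting the tail probabilities by the gap increments bounds
the expected regret. The estimates on H_i compare the weights class by class, the class sizes adding
up to K. -/

namespace EBTC

/-! ### Ordered gaps, classes of arms, layered form of the regret -/

section Gaps

variable {K : ℕ} (μ : Fin K → ℝ)

theorem card_gapValues : (gapValues μ).card = numClasses μ := by
  have : gapValues μ = (Finset.univ.image μ).image (fun y => bestMean μ - y) := by
    rw [gapValues, Finset.image_image]; rfl
  rw [this, Finset.card_image_of_injective _ (fun a b h => by simpa using h)]
  rfl

/-- For indices in range the default value of `getD` is never reached, so the order properties of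
the gaps are those of an increasing enumeration. -/
theorem gap_eq_orderEmbOfFin {a : ℕ} (h1 : 1 ≤ a) (h2 : a ≤ numClasses μ) :
    gap μ a = (gapValues μ).orderEmbOfFin (card_gapValues μ) ⟨a - 1, by omega⟩ := by
  rw [gap, Finset.orderEmbOfFin_apply, List.getD_eq_getElem]
  · rfl

theorem gap_lt_gap {a b : ℕ} (h1 : 1 ≤ a) (hab : a < b) (h2 : b ≤ numClasses μ) :
    gap μ a < gap μ b := by
  rw [gap_eq_orderEmbOfFin μ h1 (by omega), gap_eq_orderEmbOfFin μ (by omega) h2]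
  apply (OrderEmbedding.lt_iff_lt _).2
  simp only [Fin.mk_lt_mk]
  omega

theorem gap_le_gap {a b : ℕ} (h1 : 1 ≤ a) (hab : a ≤ b) (h2 : b ≤ numClasses μ) :
    gap μ a ≤ gap μ b := by
  rcases hab.eq_or_lt with rfl | h
  · exact le_rfl
  · exact (gap_lt_gap μ h1 h h2).le

theorem gap_le_gap_iff {a b : ℕ} (ha : a ∈ Finset.Icc 1 (numClasses μ))
    (hb : b ∈ Finset.Icc 1 (numClasses μ)) : gap μ a ≤ gap μ b ↔ a ≤ b := by
  rw [Finset.mem_Icc] at ha hb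
  refine ⟨fun h => ?_, fun h => gap_le_gap μ ha.1 h hb.2⟩
  by_contra! hlt
  exact absurd (gap_lt_gap μ hb.1 hlt ha.2) (not_lt.2 h)

theorem gap_mem_gapValues {a : ℕ} (h1 : 1 ≤ a) (h2 : a ≤ numClasses μ) :
    gap μ a ∈ gapValues μ := by
  rw [gap_eq_orderEmbOfFin μ h1 h2]
  exact Finset.orderEmbOfFin_mem _ _ _

theorem exists_class (k : Fin K) :
    ∃ m ∈ Finset.Icc 1 (numClasses μ), bestMean μ - μ k = gap μ m := by
  have hk : bestMean μ - μ k ∈ gapValues μ := Finset.mem_image_of_mem _ (Finset.mem_univ k)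
  have : bestMean μ - μ k ∈ Set.range ((gapValues μ).orderEmbOfFin (card_gapValues μ)) := by
    rw [Finset.range_orderEmbOfFin]; exact hk
  obtain ⟨a, ha⟩ := this
  have := a.2
  refine ⟨a + 1, Finset.mem_Icc.2 ⟨by omega, by omega⟩, ?_⟩
  rw [gap_eq_orderEmbOfFin μ (by omega) (by omega), ← ha]
  rfl

theorem le_bestMean (k : Fin K) : μ k ≤ bestMean μ :=
  le_ciSup (Set.finite_range μ).bddAbove k

theorem exists_eq_bestMean (hK : 0 < K) : ∃ k, μ k = bestMean μ := by
  have : Nonempty (Fin K) := ⟨⟨0, hK⟩⟩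
  exact exists_eq_ciSup_of_finite

theorem numClasses_pos (hK : 0 < K) : 1 ≤ numClasses μ := by
  obtain ⟨m, hm, -⟩ := exists_class μ ⟨0, hK⟩
  rw [Finset.mem_Icc] at hm
  omega

theorem gap_one (hK : 0 < K) : gap μ 1 = 0 := by
  obtain ⟨k, hk⟩ := exists_eq_bestMean μ hK
  obtain ⟨m, hm, hkm⟩ := exists_class μ k
  rw [Finset.mem_Icc] at hm
  have h1 : gap μ 1 ≤ gap μ m := gap_le_gap μ le_rfl hm.1 hm.2
  obtain ⟨l, -, hl⟩ := Finset.mem_image.1 (gap_mem_gapValues μ le_rfl (numClasses_pos μ hK))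
  have := le_bestMean μ l
  linarith

theorem gap_pos (hK : 0 < K) {a : ℕ} (h1 : 2 ≤ a) (h2 : a ≤ numClasses μ) : 0 < gap μ a := by
  rw [← gap_one μ hK]
  exact gap_lt_gap μ le_rfl (by omega) h2

theorem gap_nonneg (hK : 0 < K) {a : ℕ} (h1 : 1 ≤ a) (h2 : a ≤ numClasses μ) : 0 ≤ gap μ a := by
  rw [← gap_one μ hK]
  exact gap_le_gap μ le_rfl h1 h2

/-- Each arm lies in exactly one class because the gaps are strictly increasing. This turns
thresholds summed over arms into the class sums of the complexities. -/
theorem sum_comp_gap (f : ℝ → ℝ) :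
    ∑ k, f (bestMean μ - μ k) = ∑ m ∈ Finset.Icc 1 (numClasses μ), classCard μ m * f (gap μ m) := by
  choose c hc hcg using exists_class μ
  rw [← Finset.sum_fiberwise_of_maps_to (s := Finset.univ) (g := c) (fun k _ => hc k)]
  refine Finset.sum_congr rfl fun m hm => ?_
  have hf : Finset.univ.filter (fun k => c k = m)
      = Finset.univ.filter fun k => bestMean μ - μ k = gap μ m := by
    ext k
    simp only [Finset.mem_filter, Finset.mem_univ, true_and]
    refine ⟨fun h => h ▸ hcg k, fun h => ?_⟩
    have h' : gap μ (c k) = gap μ m := (hcg k).symm.trans h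
    exact le_antisymm ((gap_le_gap_iff μ (hc k) hm).1 h'.le)
      ((gap_le_gap_iff μ hm (hc k)).1 h'.ge)
  rw [hf, classCard, Finset.card_eq_sum_ones, Nat.cast_sum, Finset.sum_mul]
  refine Finset.sum_congr rfl fun k hk => ?_
  rw [(Finset.mem_filter.1 hk).2]
  simp

theorem sum_classCard : ∑ m ∈ Finset.Icc 1 (numClasses μ), (classCard μ m : ℝ) = K := by
  have := sum_comp_gap μ (fun _ => 1)
  simpa using this.symm

theorem numBest_eq (hK : 0 < K) : numBest μ = classCard μ 1 := by
  rw [numBest, classCard, gap_one μ hK]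
  congr 1
  ext k
  simp only [Finset.mem_filter, Finset.mem_univ, true_and, sub_eq_zero]
  exact eq_comm

theorem sum_Icc_split (f : ℕ → ℝ) {a b c : ℕ} (hab : a ≤ b + 1) (hbc : b ≤ c) :
    ∑ k ∈ Finset.Icc a c, f k = ∑ k ∈ Finset.Icc a b, f k + ∑ k ∈ Finset.Icc (b + 1) c, f k := by
  rw [← Finset.sum_union]
  · congr 1
    ext k
    simp only [Finset.mem_union, Finset.mem_Icc]
    omega
  · rw [Finset.disjoint_left]
    intro k
    simp only [Finset.mem_Icc]
    omega

theorem sum_Icc_one_classCard (hK : 0 < K) {j : ℕ} (hj : 1 ≤ j) :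
    ∑ k ∈ Finset.Icc 1 j, (classCard μ k : ℝ)
      = numBest μ + ∑ k ∈ Finset.Icc 2 j, (classCard μ k : ℝ) := by
  rw [sum_Icc_split _ (b := 1) (by omega) hj, numBest_eq μ hK]
  simp

/-- The regret of an arm as a sum of gap increments. -/
theorem regret_eq_sum (hK : 0 < K) (k : Fin K) :
    bestMean μ - μ k = ∑ i ∈ Finset.Icc 1 (numClasses μ - 1),
      (gap μ (i + 1) - gap μ i) * (if gap μ (i + 1) ≤ bestMean μ - μ k then 1 else 0) := by
  obtain ⟨m, hm, hk⟩ := exists_class μ k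
  have hm' := Finset.mem_Icc.1 hm
  rw [hk, sum_Icc_split _ (b := m - 1) (by omega) (by omega)]
  have h1 : ∀ m, ∑ i ∈ Finset.Icc 1 m, (gap μ (i + 1) - gap μ i) = gap μ (m + 1) - gap μ 1 := by
    intro m
    induction m with
    | zero => simp
    | succ m ih => rw [Finset.sum_Icc_succ_top (by omega), ih]; ring
  rw [Finset.sum_congr rfl (g := fun i => gap μ (i + 1) - gap μ i), h1,
    Finset.sum_eq_zero (s := Finset.Icc (m - 1 + 1) _), gap_one μ hK,
    Nat.sub_add_cancel hm'.1]
  · ring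
  · intro i hi
    rw [Finset.mem_Icc] at hi
    rw [if_neg, mul_zero]
    exact not_le.2 (gap_lt_gap μ hm'.1 (by omega) (by omega))
  · intro i hi
    rw [Finset.mem_Icc] at hi
    rw [if_pos, mul_one]
    exact gap_le_gap μ (by omega) (by omega) (by omega)

end Gaps

/-! ### Upper and lower bounds on the complexities -/

section Complexities

variable {K : ℕ} (μ : Fin K → ℝ) {ε₀ : ℝ}

theorem cTwo_pos (hK : 0 < K) (hε : 0 < ε₀) {i j : ℕ} (hj : 1 ≤ j) (hji : j < i)
    (hi : i ≤ numClasses μ) : 0 < cTwo μ ε₀ i j := by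
  have h1 := gap_lt_gap μ hj hji hi
  have h2 := gap_nonneg μ hK hj (by omega)
  have : 0 < gap μ i - gap μ j := by linarith
  unfold cTwo
  positivity

theorem sum_classCard_split (hK : 0 < K) {i j : ℕ} (hj : 1 ≤ j) (hji : j ≤ i)
    (hi : i + 1 ≤ numClasses μ) :
    (numBest μ : ℝ) + (∑ k ∈ Finset.Icc 2 j, (classCard μ k : ℝ)
        + ∑ k ∈ Finset.Icc (i + 1) (numClasses μ), (classCard μ k : ℝ))
      + ∑ k ∈ Finset.Icc (j + 1) i, (classCard μ k : ℝ) = K := by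
  rw [← sum_classCard μ,
    sum_Icc_split _ (a := 1) (b := i) (c := numClasses μ) (by omega) (by omega),
    sum_Icc_split _ (a := 1) (b := j) (c := i) (by omega) hji, sum_Icc_one_classCard μ hK hj]
  ring

/-- Every squared weight in H̄ is at least c_{i+1,j}², and the class sizes total K. This is all the
counting argument uses of H̄. -/
theorem le_hBar (hK : 0 < K) (hε : 0 < ε₀) {i j : ℕ} (hj : 1 ≤ j) (hji : j ≤ i)
    (hi : i + 1 ≤ numClasses μ) : K * cTwo μ ε₀ (i + 1) j ^ 2 ≤ hBar μ ε₀ i j := by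
  have hc := (cTwo_pos μ hK hε hj (by omega : j < i + 1) hi).le
  rw [hBar, ← sum_classCard_split μ hK hj hji hi, add_mul, add_mul, Finset.sum_mul,
    mul_comm (_ + _) (cTwo _ _ _ _ ^ 2)]
  gcongr
  · exact le_max_right _ _
  · exact le_max_right _ _
  · exact (le_max_right _ _).trans (le_max_left _ _)

theorem hBar_le (hK : 0 < K) (hε : 0 < ε₀) {i j : ℕ} (hj : 1 ≤ j) (hji : j ≤ i)
    (hi : i + 1 ≤ numClasses μ) :
    hBar μ ε₀ i j ≤ K * max (2 / gap μ (j + 1)) (cTwo μ ε₀ (i + 1) j) ^ 2 := by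
  have hc := (cTwo_pos μ hK hε hj (by omega : j < i + 1) hi).le
  have hg := gap_pos μ hK (by omega : 2 ≤ j + 1) (by omega)
  have h2 : √2 ≤ 2 := by rw [Real.sqrt_le_left (by norm_num)]; norm_num
  have hone : cOne μ ε₀ (j + 1) ≤ 2 / gap μ (j + 1) := by
    rw [cOne]; have : 0 < 1 / ε₀ := by positivity
    linarith
  rw [hBar, ← sum_classCard_split μ hK hj hji hi, add_mul, add_mul, Finset.sum_mul,
    mul_comm (_ + _) (_ ^ 2)]
  refine add_le_add (add_le_add ?_ ?_) (Finset.sum_le_sum fun k hk => ?_)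
  · gcongr
  · refine mul_le_mul_of_nonneg_right (pow_le_pow_left₀ ?_ (max_le_max hone le_rfl) 2)
      (by positivity)
    exact hc.trans (le_max_right _ _)
  · rw [Finset.mem_Icc] at hk
    refine mul_le_mul_of_nonneg_left (pow_le_pow_left₀ ?_ ?_ 2) (by positivity)
    · exact hc.trans ((le_max_right _ _).trans (le_max_left _ _))
    refine max_le (max_le_max hone le_rfl) ((div_le_div₀ (by norm_num) h2 hg ?_).trans
      (le_max_left _ _))
    exact gap_le_gap μ (by omega) hk.1 (by omega)

/-- The left side is the average of the two terms of the maximum. -/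
theorem one_div_gap_le {j : ℕ} :
    1 / gap μ (j + 1) ≤ max (cOne μ ε₀ (j + 1)) (1 / ε₀) := by
  have h1 := le_max_left (cOne μ ε₀ (j + 1)) (1 / ε₀)
  have h2 := le_max_right (cOne μ ε₀ (j + 1)) (1 / ε₀)
  rw [cOne, show 2 / gap μ (j + 1) = 2 * (1 / gap μ (j + 1)) by ring] at h1 h2 ⊢
  linarith

/-- The left side is what the counting argument produces; the discarded terms of H̃ are nonnegative.
-/
theorem le_hTilde (hε : 0 < ε₀) {i j : ℕ} :
    (∑ k ∈ Finset.Icc 1 j, (classCard μ k : ℝ)) * (1 / (gap μ (i + 1) - gap μ j) ^ 2)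
      + (∑ k ∈ Finset.Icc (j + 1) (numClasses μ), (classCard μ k : ℝ))
        * max (cOne μ ε₀ (j + 1)) (1 / ε₀) ^ 2 ≤ hTilde μ ε₀ i j := by
  have hm : 0 ≤ max (cOne μ ε₀ (j + 1)) (1 / ε₀) :=
    le_trans (by positivity) (le_max_right _ _)
  have h1 : (∑ k ∈ Finset.Icc (j + 1) (numClasses μ), (classCard μ k : ℝ))
        * max (cOne μ ε₀ (j + 1)) (1 / ε₀) ^ 2
      ≤ ∑ k ∈ Finset.Icc (j + 1) (numClasses μ), (classCard μ k : ℝ)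
        * (max (max (cOne μ ε₀ (j + 1)) (1 / ε₀)) (√2 / gap μ k)) ^ 2 := by
    rw [Finset.sum_mul]
    exact Finset.sum_le_sum fun k _ => mul_le_mul_of_nonneg_left
      (pow_le_pow_left₀ hm (le_max_left _ _) 2) (by positivity)
  have h2 : 0 ≤ 2 * (numBest μ : ℝ) / gap μ (j + 1) ^ 2 := by positivity
  have h3 : 0 ≤ (max (cOne μ ε₀ (j + 1)) (1 / ε₀)) ^ 2
      * ∑ k ∈ Finset.Icc 2 j, (classCard μ k : ℝ) := by positivity
  have h4 : 0 ≤ (∑ k ∈ Finset.Icc 1 j, (classCard μ k : ℝ))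
      * (1 / (gap μ (i + 1) - gap μ j) ^ 2) := by positivity
  have h5 : 2 * (∑ k ∈ Finset.Icc 1 j, (classCard μ k : ℝ)) / (gap μ (i + 1) - gap μ j) ^ 2
    = 2 * ((∑ k ∈ Finset.Icc 1 j, (classCard μ k : ℝ))
      * (1 / (gap μ (i + 1) - gap μ j) ^ 2)) := by rw [mul_one_div, mul_div_assoc]
  rw [hTilde, h5]
  linarith

/-- Best arms occur in the first and third terms with coefficient 1/2 each. Classes 2 to j have
coefficient 1 + 1/2, and the others 1. Hence the excess over K. -/
theorem hTilde_le (hK : 0 < K) (hε : 0 < ε₀) {i j : ℕ} (hj : 1 ≤ j) (hji : j ≤ i)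
    (hi : i + 1 ≤ numClasses μ) :
    hTilde μ ε₀ i j ≤ (K + 1 / 2 * ∑ k ∈ Finset.Icc 2 j, (classCard μ k : ℝ))
      * max (2 / gap μ (j + 1)) (cTwo μ ε₀ (i + 1) j) ^ 2 := by
  set M := max (2 / gap μ (j + 1)) (cTwo μ ε₀ (i + 1) j) with hM
  have hg := gap_pos μ hK (by omega : 2 ≤ j + 1) (by omega)
  have hgj := gap_nonneg μ hK hj (by omega)
  have hd : 0 < gap μ (i + 1) - gap μ j := sub_pos.2 (gap_lt_gap μ hj (by omega) hi)
  have h2 : √2 ≤ 2 := by rw [Real.sqrt_le_left (by norm_num)]; norm_num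
  have hM1 : 2 / gap μ (j + 1) ≤ M := le_max_left _ _
  have hM2 : cTwo μ ε₀ (i + 1) j ≤ M := le_max_right _ _
  have hM0 : 0 ≤ M := le_trans (by positivity) hM1
  have hM3 : 2 / (gap μ (i + 1) - gap μ j) ≤ M := by
    refine le_trans ?_ hM2
    rw [cTwo]
    have : 1 / (gap μ (i + 1) - gap μ j)
        ≤ (gap μ j / ε₀ + 1) / (gap μ (i + 1) - gap μ j) := by
      gcongr
      have : 0 ≤ gap μ j / ε₀ := by positivity
      linarith
    have h3 : 0 < 3 / ε₀ := by positivity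
    rw [show 2 / (gap μ (i + 1) - gap μ j) = 2 * (1 / (gap μ (i + 1) - gap μ j)) by ring]
    linarith
  have hM4 : 1 / ε₀ ≤ M := by
    refine le_trans ?_ hM2
    rw [cTwo]
    have : 0 ≤ 2 * ((gap μ j / ε₀ + 1) / (gap μ (i + 1) - gap μ j)) := by positivity
    have : 1 / ε₀ ≤ 3 / ε₀ := by gcongr; norm_num
    linarith
  have hM5 : max (cOne μ ε₀ (j + 1)) (1 / ε₀) ≤ M := by
    refine max_le (le_trans ?_ hM1) hM4
    rw [cOne]; have : 0 < 1 / ε₀ := by positivity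
    linarith
  have hm0 : 0 ≤ max (cOne μ ε₀ (j + 1)) (1 / ε₀) :=
    le_trans (by positivity) (le_max_right _ _)
  have e1 : 2 * (numBest μ : ℝ) / gap μ (j + 1) ^ 2 ≤ 1 / 2 * numBest μ * M ^ 2 := by
    calc 2 * (numBest μ : ℝ) / gap μ (j + 1) ^ 2
        = 1 / 2 * numBest μ * (2 / gap μ (j + 1)) ^ 2 := by ring
      _ ≤ _ := by gcongr
  have e2 : (max (cOne μ ε₀ (j + 1)) (1 / ε₀)) ^ 2 * ∑ k ∈ Finset.Icc 2 j, (classCard μ k : ℝ)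
      ≤ M ^ 2 * ∑ k ∈ Finset.Icc 2 j, (classCard μ k : ℝ) := by gcongr
  have e3 : 2 * (∑ k ∈ Finset.Icc 1 j, (classCard μ k : ℝ)) / (gap μ (i + 1) - gap μ j) ^ 2
      ≤ 1 / 2 * (∑ k ∈ Finset.Icc 1 j, (classCard μ k : ℝ)) * M ^ 2 := by
    calc 2 * (∑ k ∈ Finset.Icc 1 j, (classCard μ k : ℝ)) / (gap μ (i + 1) - gap μ j) ^ 2
        = 1 / 2 * (∑ k ∈ Finset.Icc 1 j, (classCard μ k : ℝ))
          * (2 / (gap μ (i + 1) - gap μ j)) ^ 2 := by rw [div_pow]; ring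
      _ ≤ _ := by gcongr
  have e4 : ∑ k ∈ Finset.Icc (j + 1) (numClasses μ), (classCard μ k : ℝ)
        * (max (max (cOne μ ε₀ (j + 1)) (1 / ε₀)) (√2 / gap μ k)) ^ 2
      ≤ (∑ k ∈ Finset.Icc (j + 1) (numClasses μ), (classCard μ k : ℝ)) * M ^ 2 := by
    rw [Finset.sum_mul]
    refine Finset.sum_le_sum fun k hk => mul_le_mul_of_nonneg_left
      (pow_le_pow_left₀ (hm0.trans (le_max_left _ _)) ?_ 2) (by positivity)
    rw [Finset.mem_Icc] at hk
    refine max_le hM5 ((div_le_div₀ (by norm_num) h2 hg ?_).trans hM1)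
    exact gap_le_gap μ (by omega) hk.1 (by omega)
  have e5 := sum_Icc_one_classCard μ hK hj
  have e6 : (K : ℝ) = ∑ k ∈ Finset.Icc 1 j, (classCard μ k : ℝ)
      + ∑ k ∈ Finset.Icc (j + 1) (numClasses μ), (classCard μ k : ℝ) := by
    rw [← sum_classCard μ, sum_Icc_split _ (b := j) (by omega) (by omega)]
  rw [hTilde, e6, e5]
  rw [e5] at e3
  nlinarith

theorem complexity_le {i j : ℕ} (hj : j ∈ Finset.Icc 1 i) :
    complexity μ ε₀ i ≤ max (hBar μ ε₀ i j) (hTilde μ ε₀ i j) :=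
  ciInf_le (f := fun j : Finset.Icc 1 i => max (hBar μ ε₀ i j) (hTilde μ ε₀ i j))
    (Set.finite_range _).bddBelow ⟨j, hj⟩

theorem exists_complexity_eq {i : ℕ} (hi : 1 ≤ i) :
    ∃ j ∈ Finset.Icc 1 i, max (hBar μ ε₀ i j) (hTilde μ ε₀ i j) = complexity μ ε₀ i := by
  have : Nonempty (Finset.Icc 1 i) := ⟨⟨1, by simpa using hi⟩⟩
  obtain ⟨j, hj⟩ := exists_eq_ciInf_of_finite
    (f := fun j : Finset.Icc 1 i => max (hBar μ ε₀ i j) (hTilde μ ε₀ i j))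
  exact ⟨j, j.2, hj⟩

theorem complexity_one (hK : 0 < K) (hε : 0 < ε₀) (hC : 2 ≤ numClasses μ) :
    complexity μ ε₀ 1 = K * (2 / gap μ 2 + 3 / ε₀) ^ 2 := by
  have hc : cTwo μ ε₀ 2 1 = 2 / gap μ 2 + 3 / ε₀ := by
    rw [cTwo, gap_one μ hK]; ring
  have hg := gap_pos μ hK le_rfl hC
  have hM : max (2 / gap μ 2) (cTwo μ ε₀ 2 1) = cTwo μ ε₀ 2 1 := by
    refine max_eq_right ?_
    rw [hc]; have : 0 < 3 / ε₀ := by positivity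
    linarith
  have h1 := le_hBar μ hK hε le_rfl (le_refl 1) hC
  have h2 := hBar_le μ hK hε le_rfl (le_refl 1) hC
  have h3 := hTilde_le μ hK hε le_rfl (le_refl 1) hC
  simp only [Nat.reduceAdd, hM] at h1 h2 h3
  rw [Finset.Icc_eq_empty (by norm_num), Finset.sum_empty, mul_zero, add_zero] at h3
  obtain ⟨j, hj, hjc⟩ := exists_complexity_eq μ (ε₀ := ε₀) (le_refl 1)
  obtain rfl : j = 1 := by simpa using hj
  rw [← hjc, ← hc]
  -- For i = j = 1 the excess sum in the bound on H̃ is empty, so both upper bounds meet the lower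
  -- bound on H̄.
  exact le_antisymm (max_le h2 h3) (h1.trans (le_max_left _ _))

theorem le_complexity (hK : 0 < K) (hε : 0 < ε₀) {i : ℕ} (h1 : 1 ≤ i)
    (hi : i + 1 ≤ numClasses μ) : 2 * K / gap μ (i + 1) ^ 2 ≤ complexity μ ε₀ i := by
  obtain ⟨j, hj, hjc⟩ := exists_complexity_eq μ (ε₀ := ε₀) h1
  rw [Finset.mem_Icc] at hj
  rw [← hjc]
  refine le_trans ?_ ((le_hBar μ hK hε hj.1 hj.2 hi).trans (le_max_left _ _))
  have hg := gap_pos μ hK (by omega) hi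
  have hgj := gap_nonneg μ hK hj.1 (by omega)
  have hd : 0 < gap μ (i + 1) - gap μ j := sub_pos.2 (gap_lt_gap μ hj.1 (by omega) hi)
  have hc : 2 / gap μ (i + 1) ≤ cTwo μ ε₀ (i + 1) j := by
    rw [cTwo]
    have : 1 / gap μ (i + 1) ≤ (gap μ j / ε₀ + 1) / (gap μ (i + 1) - gap μ j) := by
      have : 0 ≤ gap μ j / ε₀ := by positivity
      apply div_le_div₀ <;> linarith
    have h3 : 0 < 3 / ε₀ := by positivity
    rw [show 2 / gap μ (i + 1) = 2 * (1 / gap μ (i + 1)) by ring]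
    linarith
  calc 2 * K / gap μ (i + 1) ^ 2 ≤ 4 * K / gap μ (i + 1) ^ 2 := by gcongr; norm_num
    _ = K * (2 / gap μ (i + 1)) ^ 2 := by ring
    _ ≤ _ := by gcongr

theorem complexity_le_mul (hK : 0 < K) (hε : 0 < ε₀) {i j : ℕ} (hj : j ∈ Finset.Icc 1 i)
    (hi : i + 1 ≤ numClasses μ) :
    complexity μ ε₀ i
      ≤ 3 / 2 * (K * max (2 / gap μ (j + 1)) (cTwo μ ε₀ (i + 1) j) ^ 2) := by
  refine (complexity_le μ hj).trans ?_
  rw [Finset.mem_Icc] at hj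
  have h1 := hBar_le μ hK hε hj.1 hj.2 hi
  have h2 := hTilde_le μ hK hε hj.1 hj.2 hi
  have h3 : ∑ k ∈ Finset.Icc 2 j, (classCard μ k : ℝ) ≤ K := by
    rw [← sum_classCard μ]
    refine Finset.sum_le_sum_of_subset_of_nonneg (Finset.Icc_subset_Icc (by omega) (by omega))
      fun _ _ _ => by positivity
  have h4 := sq_nonneg (max (2 / gap μ (j + 1)) (cTwo μ ε₀ (i + 1) j))
  have h5 : (0 : ℝ) ≤ K := by positivity
  refine max_le (h1.trans ?_) (h2.trans ?_) <;> nlinarith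

end Complexities

end EBTC

namespace EBTC

/-! ### Counting rounds under pairwise tracking -/

section Counting

variable {K : ℕ} {ε₀ : ℝ} {I : ℕ → Fin K} {X : ℕ → ℝ} {B C : ℕ → Fin K}

theorem card_filter_Ico_succ (p : ℕ → Prop) [DecidablePred p] {a n : ℕ} (h : a ≤ n) :
    ((Finset.Ico a (n + 1)).filter p).card
      = ((Finset.Ico a n).filter p).card + if p n then 1 else 0 := by
  simp only [Finset.card_filter]
  exact Finset.sum_Ico_succ_top h _

theorem pulls_mono (I : ℕ → Fin K) (i : Fin K) : Monotone fun n => pulls I n i :=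
  fun _ _ h => Finset.card_le_card
    (Finset.filter_subset_filter _ (Finset.Ico_subset_Ico_right h))

theorem pulls_lt_of_pull {t s : ℕ} (h1 : 1 ≤ t) (hts : t < s) :
    pulls I t (I t) < pulls I s (I t) := by
  refine lt_of_lt_of_le ?_ (pulls_mono I (I t) (Nat.succ_le_of_lt hts))
  simp only [pulls, Nat.succ_eq_add_one]
  rw [card_filter_Ico_succ _ h1]
  simp

theorem pulls_le (I : ℕ → Fin K) (n : ℕ) (i : Fin K) : pulls I n i ≤ n - 1 :=
  (Finset.card_filter_le _ _).trans (by simp)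

theorem IsRun.one_le_pulls {β : ℝ} (h : IsRun ε₀ β I X B C) {t : ℕ} (ht : K < t) (i : Fin K) :
    1 ≤ pulls I t i := by
  rw [← h.init i]
  exact pulls_mono I i ht

theorem IsRun.challengerPulls_bounds (h : IsRun ε₀ (1 / 2) I X B C) {i j : Fin K} (hij : i ≠ j)
    (n : ℕ) : pairCount B C n i j ≤ 2 * challengerPulls I B C n i j ∧
      2 * challengerPulls I B C n i j ≤ pairCount B C n i j + 2 := by
  induction n with
  | zero => simp [pairCount, challengerPulls]
  | succ n ih =>
    rcases lt_or_ge n (K + 1) with hn | hn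
    · simp [pairCount, challengerPulls, Finset.Ico_eq_empty_of_le (show n + 1 ≤ K + 1 by omega)]
    have ht := h.tracking n hn
    have hP := card_filter_Ico_succ (fun t => B t = i ∧ C t = j) hn
    have hQ := card_filter_Ico_succ (fun t => B t = i ∧ C t = j ∧ I t = j) hn
    change pairCount B C (n + 1) i j = pairCount B C n i j + _ at hP
    change challengerPulls I B C (n + 1) i j = challengerPulls I B C n i j + _ at hQ
    by_cases hp : B n = i ∧ C n = j
    · rw [if_pos hp] at hP
      rw [hp.1, hp.2, hP] at ht
      split_ifs at ht with hc
      · rw [if_pos ⟨hp.1, hp.2, ht⟩] at hQ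
        have : 2 * challengerPulls I B C n i j ≤ pairCount B C n i j + 1 := by
          have : (2 * challengerPulls I B C n i j : ℝ) ≤ (pairCount B C n i j + 1 : ℕ) := by
            linarith
          exact_mod_cast this
        omega
      · rw [if_neg (fun hh => hij (ht.symm.trans hh.2.2))] at hQ
        have : pairCount B C n i j + 1 < 2 * challengerPulls I B C n i j := by
          have : ((pairCount B C n i j + 1 : ℕ) : ℝ) < 2 * challengerPulls I B C n i j := by
            linarith
          exact_mod_cast this
        omega
    · rw [if_neg hp] at hP
      rw [if_neg (fun hh => hp ⟨hh.1, hh.2.1⟩)] at hQ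
      omega

/-- Each arm of a leader-challenger pair gets about half of the rounds of the pair. -/
theorem IsRun.pairCount_le (h : IsRun ε₀ (1 / 2) I X B C) {i j a : Fin K} (hij : i ≠ j)
    (ha : a = i ∨ a = j) (n : ℕ) : pairCount B C n i j ≤
      2 * ((Finset.Ico (K + 1) n).filter fun t => B t = i ∧ C t = j ∧ I t = a).card + 2 := by
  have hb := h.challengerPulls_bounds hij n
  rcases ha with rfl | rfl
  · have : pairCount B C n a j = ((Finset.Ico (K + 1) n).filter
        fun t => B t = a ∧ C t = j ∧ I t = a).card + challengerPulls I B C n a j := by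
      rw [pairCount, challengerPulls, ← Finset.card_union_of_disjoint]
      · congr 1
        ext t
        simp only [Finset.mem_filter, Finset.mem_union, Finset.mem_Ico]
        constructor
        · rintro ⟨ht, h1, h2⟩
          have := h.tracking t ht.1
          rw [h1, h2] at this
          split_ifs at this
          · exact Or.inr ⟨ht, h1, h2, this⟩
          · exact Or.inl ⟨ht, h1, h2, this⟩
        · rintro (hh | hh) <;> exact ⟨hh.1, hh.2.1, hh.2.2.1⟩
      · rw [Finset.disjoint_left]
        intro t h1 h2
        exact hij ((Finset.mem_filter.1 h1).2.2.2.symm.trans (Finset.mem_filter.1 h2).2.2.2)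
    omega
  · change _ ≤ 2 * challengerPulls I B C n i a + 2
    omega

/-- Each pull of an arm raises its count, so the counts at these rounds are distinct; after
initialisation they start from 1, so at most ⌊d⌋ values are available. -/
theorem IsRun.card_pulls_le (h : IsRun ε₀ (1 / 2) I X B C) {d : ℝ} (hd : 0 ≤ d) (a : Fin K)
    (n : ℕ) : (((Finset.Ico (K + 1) n).filter
      fun t => I t = a ∧ (pulls I t a : ℝ) ≤ d).card : ℝ) ≤ d := by
  refine le_trans ?_ (Nat.floor_le hd)
  rw [Nat.cast_le]
  have : (Finset.Icc 1 ⌊d⌋₊).card = ⌊d⌋₊ := by simp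
  rw [← this]
  refine Finset.card_le_card_of_injOn (fun t => pulls I t a) ?_ ?_
  · intro t ht
    simp only [Finset.coe_filter, Set.mem_ofPred_eq, Finset.mem_Ico] at ht
    simp only [Finset.coe_Icc, Set.mem_Icc]
    exact ⟨h.one_le_pulls ht.1.1 a, Nat.le_floor ht.2.2⟩
  · intro t ht s hs hts
    simp only [Finset.coe_filter, Set.mem_ofPred_eq, Finset.mem_Ico] at ht hs
    by_contra hne
    rcases lt_or_gt_of_ne hne with hlt | hlt
    · have := pulls_lt_of_pull (I := I) (by omega) hlt
      rw [ht.2.1] at this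
      exact absurd hts this.ne
    · have := pulls_lt_of_pull (I := I) (by omega) hlt
      rw [hs.2.1] at this
      exact absurd hts this.ne'

/-- If in every round the leader or the challenger is undersampled, few rounds have passed. -/
theorem IsRun.lt_of_undersampled (h : IsRun ε₀ (1 / 2) I X B C) (hK : 2 ≤ K) {D : Fin K → ℝ}
    (hD : ∀ k, 0 ≤ D k) {n : ℕ} (hn : K < n)
    (hU : ∀ t, K < t → t < n →
      (pulls I t (B t) : ℝ) ≤ D (B t) ∨ (pulls I t (C t) : ℝ) ≤ D (C t)) :
    (n : ℝ) < 2 * ∑ k, D k + 5 * (K : ℝ) ^ 2 / 2 := by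
  classical
  set S := Finset.Ico (K + 1) n with hS
  set G := S.filter fun t => (pulls I t (I t) : ℝ) ≤ D (I t) with hG
  set O := (Finset.univ : Finset (Fin K)).offDiag with hO
  have hmaps : ∀ t ∈ S, (B t, C t) ∈ O := by
    intro t ht
    rw [hS, Finset.mem_Ico] at ht
    simpa [hO] using (h.challenger_ne t ht.1).symm
  have hpair : ∀ p ∈ O, (S.filter fun t => (B t, C t) = p).card
      ≤ 2 * (G.filter fun t => (B t, C t) = p).card + 2 := by
    rintro ⟨i, j⟩ hp
    have hij : i ≠ j := by simpa [hO] using hp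
    rcases (S.filter fun t => (B t, C t) = (i, j)).eq_empty_or_nonempty with he | hne
    · rw [he]; simp
    -- At the last round of the pair some arm `a` is undersampled. Counts are monotone, so `a` was
    -- undersampled at all earlier rounds of the pair, in particular whenever it was pulled there.
    have hmem := Finset.max'_mem _ hne
    have hmax := Finset.le_max' (S.filter fun t => (B t, C t) = (i, j))
    set t₁ := Finset.max' _ hne
    simp only [Finset.mem_filter, Prod.mk.injEq, hS, Finset.mem_Ico] at hmem
    obtain ⟨a, ha, hNa⟩ : ∃ a, (a = i ∨ a = j) ∧ (pulls I t₁ a : ℝ) ≤ D a := by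
      have := hU t₁ hmem.1.1 hmem.1.2
      rw [hmem.2.1, hmem.2.2] at this
      rcases this with h1 | h1
      · exact ⟨i, Or.inl rfl, h1⟩
      · exact ⟨j, Or.inr rfl, h1⟩
    have hc := h.pairCount_le hij ha n
    have he : (S.filter fun t => (B t, C t) = (i, j)).card = pairCount B C n i j := by
      simp only [pairCount, Prod.mk.injEq, hS]
    rw [he]
    refine hc.trans ?_
    gcongr
    intro t ht
    simp only [Finset.mem_filter] at ht
    have hle := hmax t (by simpa using ⟨ht.1, ht.2.1, ht.2.2.1⟩)
    simp only [hG, Finset.mem_filter, Prod.mk.injEq]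
    refine ⟨⟨ht.1, ?_⟩, ht.2.1, ht.2.2.1⟩
    rw [ht.2.2.2]
    exact le_trans (by exact_mod_cast pulls_mono I a hle) hNa
  have h1 : S.card = ∑ p ∈ O, (S.filter fun t => (B t, C t) = p).card :=
    Finset.card_eq_sum_card_fiberwise hmaps
  have h2 : G.card = ∑ p ∈ O, (G.filter fun t => (B t, C t) = p).card :=
    Finset.card_eq_sum_card_fiberwise fun t ht => hmaps t (Finset.mem_filter.1 ht).1
  have h3 : G.card = ∑ a, (G.filter fun t => I t = a).card :=
    Finset.card_eq_sum_card_fiberwise fun t _ => Finset.mem_univ _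
  have h4 : (G.card : ℝ) ≤ ∑ k, D k := by
    rw [h3, Nat.cast_sum]
    refine Finset.sum_le_sum fun a _ => ?_
    refine le_trans (Nat.cast_le.2 (Finset.card_le_card ?_)) (h.card_pulls_le (hD a) a n)
    intro t ht
    simp only [hG, Finset.mem_filter] at ht ⊢
    exact ⟨ht.1.1, ht.2, ht.2 ▸ ht.1.2⟩
  have h5 : S.card ≤ 2 * G.card + 2 * (K * K - K) := by
    rw [h1, h2, Finset.mul_sum]
    refine (Finset.sum_le_sum hpair).trans ?_
    rw [Finset.sum_add_distrib, Finset.sum_const, hO, Finset.offDiag_card]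
    simp [mul_comm]
  rw [hS, Nat.card_Ico] at h5
  -- There are n - K - 1 rounds in `S`, and each of the K² - K pairs costs an additive 2. For K ≥ 2,
  -- 2K² - K + 1 < 5K²/2.
  have h6 : n + K ≤ 2 * G.card + 2 * (K * K) + 1 := by
    have : K ≤ K * K := Nat.le_mul_self K
    omega
  have h7 : (n : ℝ) + K ≤ 2 * G.card + 2 * (K * K) + 1 := by exact_mod_cast h6
  have h8 : (2 : ℝ) ≤ K := by exact_mod_cast hK
  nlinarith

end Counting

/-! ### Deterministic analysis when the empirical means are accurate -/

section Concentration

variable {K : ℕ} {ε₀ : ℝ} {I : ℕ → Fin K} {X : ℕ → ℝ} {B C : ℕ → Fin K}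

/-- The empirical means of all pairs of arms are accurate at time `t`, at level `x`. -/
def Accurate (μ : Fin K → ℝ) (x : ℝ) (I : ℕ → Fin K) (X : ℕ → ℝ) (t : ℕ) : Prop :=
  ∀ i k, i ≠ k → pulls I t i * (empMean I X t i - μ i) ^ 2
    + pulls I t k * (empMean I X t k - μ k) ^ 2 < 2 * x

theorem sub_lt_of_weighted_sq_lt {N M a b x : ℝ} (hN : 0 < N) (hM : 0 < M)
    (h : N * a ^ 2 + M * b ^ 2 < 2 * x) : a - b < √(2 * x) * √(1 / N + 1 / M) := by
  rw [← Real.sqrt_mul (le_trans (by positivity) h.le)]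
  apply Real.lt_sqrt_of_sq_lt
  have h1 : (a - b) ^ 2 ≤ (N * a ^ 2 + M * b ^ 2) * (1 / N + 1 / M) := by
    -- Cauchy–Schwarz with its defect written as a square.
    have : (N * a ^ 2 + M * b ^ 2) * (1 / N + 1 / M) - (a - b) ^ 2
        = (N * a + M * b) ^ 2 / (N * M) := by
      field_simp
      ring
    have h0 : 0 ≤ (N * a + M * b) ^ 2 / (N * M) := by positivity
    linarith
  refine h1.trans_lt (mul_lt_mul_of_pos_right h (by positivity))

/-- With both counts above 4xc², the sum of their inverses is below 1/(2xc²); this fixes the factor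
4 in all the thresholds. -/
theorem one_div_sqrt_gt {N M x c : ℝ} (hx : 0 < x) (hc : 0 < c) (hN : 4 * x * c ^ 2 < N)
    (hM : 4 * x * c ^ 2 < M) : √(2 * x) * c < 1 / √(1 / N + 1 / M) := by
  have h0 : 0 < 4 * x * c ^ 2 := by positivity
  have hN0 := h0.trans hN
  have hM0 := h0.trans hM
  have h1 : 1 / N < 1 / (4 * x * c ^ 2) := one_div_lt_one_div_of_lt h0 hN
  have h2 : 1 / M < 1 / (4 * x * c ^ 2) := one_div_lt_one_div_of_lt h0 hM
  have h3 : 1 / N + 1 / M < (1 / (√(2 * x) * c)) ^ 2 := by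
    rw [div_pow, mul_pow, Real.sq_sqrt (by positivity)]
    calc 1 / N + 1 / M < 1 / (4 * x * c ^ 2) + 1 / (4 * x * c ^ 2) := by linarith
      _ = _ := by field_simp; norm_num
  have h4 : √(1 / N + 1 / M) < 1 / (√(2 * x) * c) := by
    rw [Real.sqrt_lt' (by positivity)]; exact h3
  rw [lt_one_div (by positivity) (Real.sqrt_pos.2 (by positivity))]
  exact h4

variable {μ : Fin K → ℝ} {x : ℝ} {t : ℕ}

theorem IsRun.pulls_pos {β : ℝ} (h : IsRun ε₀ β I X B C) (ht : K < t) (i : Fin K) :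
    (0 : ℝ) < pulls I t i := by
  exact_mod_cast h.one_le_pulls ht i

theorem IsRun.radius_pos {β : ℝ} (h : IsRun ε₀ β I X B C) (ht : K < t) (i k : Fin K) :
    0 < √(1 / (pulls I t i : ℝ) + 1 / (pulls I t k : ℝ)) := by
  have := h.pulls_pos ht i
  have := h.pulls_pos ht k
  exact Real.sqrt_pos.2 (by positivity)

theorem Accurate.sub_lt {β : ℝ} (hA : Accurate μ x I X t) (h : IsRun ε₀ β I X B C) (ht : K < t)
    {i k : Fin K} (hik : i ≠ k) : empMean I X t i - empMean I X t k
      < μ i - μ k + √(2 * x) * √(1 / (pulls I t i : ℝ) + 1 / (pulls I t k : ℝ)) := by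
  have := sub_lt_of_weighted_sq_lt (h.pulls_pos ht i) (h.pulls_pos ht k) (hA i k hik)
  linarith

theorem Accurate.regret_lt {β : ℝ} (hA : Accurate μ x I X t) (h : IsRun ε₀ β I X B C)
    (ht : K < t) {k : Fin K} (hk : B t ≠ k) : μ k - μ (B t)
      < √(2 * x) * √(1 / (pulls I t (B t) : ℝ) + 1 / (pulls I t k : ℝ)) := by
  have := hA.sub_lt h ht hk
  have := h.leader t ht k
  linarith

theorem Accurate.transportCost_lt {β : ℝ} (hA : Accurate μ x I X t) (h : IsRun ε₀ β I X B C)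
    (ht : K < t) {i k : Fin K} (hik : i ≠ k) : transportCost I X ε₀ t i k
      < (μ i - μ k + ε₀) / √(1 / (pulls I t i : ℝ) + 1 / (pulls I t k : ℝ)) + √(2 * x) := by
  have hr := h.radius_pos ht i k
  rw [transportCost, div_add' _ _ _ hr.ne']
  have := hA.sub_lt h ht hik
  refine div_lt_div_of_pos_right ?_ hr
  linarith

/-- When leader and challenger are both well sampled, every challenger is costly. -/
theorem IsRun.lt_transportCost {β : ℝ} (h : IsRun ε₀ β I X B C) (hε : 0 < ε₀) (ht : K < t)
    (hx : 0 < x) {c : ℝ} (hc : 0 < c) (hB : 4 * x * c ^ 2 < pulls I t (B t))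
    (hC : 4 * x * c ^ 2 < pulls I t (C t)) {k : Fin K} (hk : k ≠ B t) :
    ε₀ * (√(2 * x) * c) < transportCost I X ε₀ t (B t) k := by
  refine lt_of_lt_of_le ?_ (h.challenger t ht k hk)
  have h1 := one_div_sqrt_gt hx hc hB hC
  have hr := h.radius_pos ht (B t) (C t)
  have h2 := h.leader t ht (C t)
  calc ε₀ * (√(2 * x) * c)
      < ε₀ * (1 / √(1 / (pulls I t (B t) : ℝ) + 1 / (pulls I t (C t) : ℝ))) := by gcongr
    _ = ε₀ / √(1 / (pulls I t (B t) : ℝ) + 1 / (pulls I t (C t) : ℝ)) := by ring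
    _ ≤ _ := by
      rw [transportCost]
      gcongr
      linarith

/-- If a bad arm `k` is undersampled, then so is the leader or the challenger. -/
theorem IsRun.undersampled_of_bad_arm {β : ℝ} (h : IsRun ε₀ β I X B C) (hε : 0 < ε₀) (ht : K < t)
    (hx : 0 < x) (hA : Accurate μ x I X t) {g d : ℝ} (hg : 0 ≤ g) (hd : 0 < d) {k : Fin K}
    (hdk : d ≤ bestMean μ - μ k - g)
    (hk : (pulls I t k : ℝ) ≤ 4 * x / (bestMean μ - μ k - g) ^ 2) :
    (pulls I t (B t) : ℝ) ≤ 4 * x * (2 * ((g / ε₀ + 1) / d) + 3 / ε₀) ^ 2 ∨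
      (pulls I t (C t) : ℝ) ≤ 4 * x * (2 * ((g / ε₀ + 1) / d) + 3 / ε₀) ^ 2 := by
  by_contra! hcon
  obtain ⟨hB, hC⟩ := hcon
  set c := 2 * ((g / ε₀ + 1) / d) + 3 / ε₀ with hc
  set w := bestMean μ - μ k - g with hw
  have hw0 : 0 < w := hd.trans_le hdk
  have hcd : 1 / w ≤ c := by
    have h1 : 1 / w ≤ (g / ε₀ + 1) / d := by
      have : 0 ≤ g / ε₀ := by positivity
      apply div_le_div₀ <;> linarith
    have h2 : 0 ≤ (g / ε₀ + 1) / d := by positivity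
    have h3 : 0 < 3 / ε₀ := by positivity
    linarith
  have hc0 : 0 < c := by positivity
  -- The leader has more than 4xc² pulls, while `k` has at most 4x/w² ≤ 4xc².
  have hkB : k ≠ B t := by
    rintro rfl
    have : 4 * x / w ^ 2 ≤ 4 * x * c ^ 2 := by
      calc 4 * x / w ^ 2 = 4 * x * (1 / w) ^ 2 := by field_simp
        _ ≤ _ := by gcongr
    linarith
  have h1 := h.lt_transportCost hε ht hx hc0 hB hC hkB
  have h2 := hA.transportCost_lt h ht hkB.symm
  have hr := h.radius_pos ht (B t) k
  set r := √(1 / (pulls I t (B t) : ℝ) + 1 / (pulls I t k : ℝ)) with hrdef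
  set y := √(2 * x) with hy
  have hy0 : 0 < y := Real.sqrt_pos.2 (by positivity)
  have hy2 : y ^ 2 = 2 * x := Real.sq_sqrt (by positivity)
  have hN := h.pulls_pos ht k
  have hNB := h.pulls_pos ht (B t)
  -- The few pulls of `k` alone give r ≥ w/(√2·y); 3/2 is a rational bound for √2. The cost of `k`
  -- is then below y(5/2 + 2(g + ε₀)/d), whereas `c` is chosen so that ε₀yc = y(3 + 2(g + ε₀)/d).
  have hry : w / (3 / 2 * y) ≤ r := by
    apply Real.le_sqrt_of_sq_le
    have : 1 / (4 * x / w ^ 2) ≤ 1 / (pulls I t k : ℝ) := one_div_le_one_div_of_le hN hk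
    have h0 : 0 < 1 / (pulls I t (B t) : ℝ) := by positivity
    have h3 : (w / (3 / 2 * y)) ^ 2 ≤ 1 / (4 * x / w ^ 2) := by
      rw [div_pow, mul_pow, hy2, one_div_div]
      refine div_le_div_of_nonneg_left (by positivity) (by positivity) ?_
      linarith
    linarith
  have hμ : μ (B t) - μ k ≤ w + g := by
    have := le_bestMean μ (B t)
    linarith
  have h3 : (μ (B t) - μ k + ε₀) / r ≤ (w + g + ε₀) * (3 / 2 * y / w) := by
    calc (μ (B t) - μ k + ε₀) / r ≤ (w + g + ε₀) / r := by gcongr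
      _ ≤ (w + g + ε₀) / (w / (3 / 2 * y)) := by gcongr
      _ = _ := by field_simp
  have h4 : (w + g + ε₀) * (3 / 2 * y / w) ≤ y * (3 / 2 + 2 * ((g + ε₀) / d)) := by
    calc (w + g + ε₀) * (3 / 2 * y / w) = y * (3 / 2 + 3 / 2 * ((g + ε₀) / w)) := by
          field_simp; ring
      _ ≤ y * (3 / 2 + 2 * ((g + ε₀) / d)) := by
          gcongr
          norm_num
  have h5 : ε₀ * (y * c) = y * (3 + 2 * ((g + ε₀) / d)) := by
    rw [hc]; field_simp; ring
  rw [h5] at h1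
  nlinarith

/-- If neither the leader nor the challenger is among the arms of gap less than `d`, then one
of them is undersampled. -/
theorem IsRun.undersampled_of_leader {β : ℝ} (h : IsRun ε₀ β I X B C) (hε : 0 < ε₀) (ht : K < t)
    (hx : 0 < x) (hA : Accurate μ x I X t) {d m : ℝ} (hd : 0 < d) (hmd : 1 / d ≤ m)
    (hmε : 1 / ε₀ ≤ m) (hB : d ≤ bestMean μ - μ (B t)) :
    (pulls I t (B t) : ℝ) ≤ 4 * x * m ^ 2 ∨ (pulls I t (C t) : ℝ) ≤ 4 * x * m ^ 2 := by
  by_contra! hcon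
  obtain ⟨hNB, hNC⟩ := hcon
  have hm0 : 0 < m := lt_of_lt_of_le (by positivity) hmd
  obtain ⟨s, hs⟩ := exists_eq_bestMean μ (Fin.pos (B t))
  have hsB : s ≠ B t := by
    rintro rfl
    linarith
  have h1 := h.lt_transportCost hε ht hx hm0 hNB hNC hsB
  have h2 := hA.transportCost_lt h ht hsB.symm
  have h3 := hA.regret_lt h ht hsB.symm
  have hr := h.radius_pos ht (B t) s
  set r := √(1 / (pulls I t (B t) : ℝ) + 1 / (pulls I t s : ℝ)) with hrdef
  set y := √(2 * x) with hy
  have hy0 : 0 < y := Real.sqrt_pos.2 (by positivity)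
  rw [← hs] at hB
  set D := μ s - μ (B t) with hD
  have hD0 : 0 < D := hd.trans_le hB
  have e : μ (B t) - μ s + ε₀ = ε₀ - D := by rw [hD]; ring
  rw [e] at h2
  -- If D ≥ ε₀, the cost of the best arm `s` is below y ≤ ε₀ym. Otherwise the leadership of `B t`
  -- gives 1/r < y/D, and the cost is below ε₀y/D ≤ ε₀ym.
  rcases le_total ε₀ D with hle | hle
  · have h4 : (ε₀ - D) / r ≤ 0 := div_nonpos_of_nonpos_of_nonneg (by linarith) hr.le
    have h5 : 1 ≤ ε₀ * m := by rwa [div_le_iff₀' hε] at hmε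
    nlinarith
  · have h4 : (ε₀ - D) / r ≤ (ε₀ - D) * (y / D) := by
      rw [div_eq_mul_one_div]
      refine mul_le_mul_of_nonneg_left ?_ (by linarith)
      rw [div_le_div_iff₀ hr hD0]
      linarith
    have h5 : (ε₀ - D) * (y / D) + y = ε₀ * (y * (1 / D)) := by field_simp; ring
    have h6 : 1 / D ≤ m := le_trans (one_div_le_one_div_of_le hd hB) hmd
    have h7 : ε₀ * (y * (1 / D)) ≤ ε₀ * (y * m) := by gcongr
    linarith

/-- On the event where all empirical means are accurate, the recommended arm is good as soon as
the number of rounds exceeds the complexity. -/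
theorem IsRun.regret_lt_gap (h : IsRun ε₀ (1 / 2) I X B C) (hε : 0 < ε₀) (hK : 2 ≤ K) {n : ℕ}
    (hn : K < n) (hx : 0 < x) (hA : ∀ t, K < t → t ≤ n → Accurate μ x I X t) {i : ℕ} (hi1 : 1 ≤ i)
    (hi : i + 1 ≤ numClasses μ)
    (hcn : 8 * x * complexity μ ε₀ i + 5 * (K : ℝ) ^ 2 / 2 ≤ n) :
    bestMean μ - μ (B n) < gap μ (i + 1) := by
  by_contra! hbad
  have hK0 : 0 < K := by omega
  obtain ⟨j, hj, hjc⟩ := exists_complexity_eq μ (ε₀ := ε₀) hi1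
  rw [Finset.mem_Icc] at hj
  have hgj := gap_nonneg μ hK0 hj.1 (by omega)
  have hgj1 := gap_pos μ hK0 (by omega : 2 ≤ j + 1) (by omega)
  have hd : 0 < gap μ (i + 1) - gap μ j := sub_pos.2 (gap_lt_gap μ hj.1 (by omega) hi)
  set d := gap μ (i + 1) - gap μ j with hddef
  set w := bestMean μ - μ (B n) - gap μ j with hw
  have hdw : d ≤ w := by rw [hw, hddef]; linarith
  have hw0 : 0 < w := hd.trans_le hdw
  have hmono : ∀ t, t < n → ∀ k, (pulls I t k : ℝ) ≤ pulls I n k := fun t ht k => by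
    exact_mod_cast pulls_mono I k ht.le
  -- Few pulls of the bad arm at time n means few at all earlier times, so the same threshold works
  -- for every arm.
  rcases le_or_gt (pulls I n (B n) : ℝ) (4 * x / w ^ 2) with hk | hk
  · have := h.lt_of_undersampled hK (D := fun _ => 4 * x * cTwo μ ε₀ (i + 1) j ^ 2)
      (fun _ => by positivity) hn fun t ht htn =>
        h.undersampled_of_bad_arm hε ht hx (hA t ht htn.le) hgj hd hdw ((hmono t htn _).trans hk)
    rw [Finset.sum_const, Finset.card_univ, Fintype.card_fin, nsmul_eq_mul] at this
    have h1 := (le_hBar μ hK0 hε hj.1 hj.2 hi).trans (le_max_left _ (hTilde μ ε₀ i j))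
    rw [hjc] at h1
    nlinarith
  -- A well-sampled bad arm accounts for at most half of the squared radius needed to beat `l`; the
  -- other half must come from 1/N_l.
  · have hgood : ∀ l, bestMean μ - μ l ≤ gap μ j → (pulls I n l : ℝ) ≤ 4 * x / d ^ 2 := by
      intro l hl
      have hlB : B n ≠ l := by
        rintro rfl
        linarith
      have h1 := (hA n hn le_rfl).regret_lt h hn hlB
      have hN := h.pulls_pos hn l
      have hNB := h.pulls_pos hn (B n)
      rw [← Real.sqrt_mul (by positivity)] at h1
      have h2 : w ^ 2 < 2 * x * (1 / (pulls I n (B n) : ℝ) + 1 / (pulls I n l : ℝ)) :=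
        (Real.lt_sqrt hw0.le).1 (lt_of_le_of_lt (by linarith) h1)
      have h3 : 1 / (pulls I n (B n) : ℝ) < w ^ 2 / (4 * x) := by
        have := one_div_lt_one_div_of_lt (by positivity) hk
        rwa [one_div_div] at this
      have h4 : w ^ 2 / 2 < 2 * x * (1 / (pulls I n l : ℝ)) := by
        have e : 2 * x * (w ^ 2 / (4 * x)) = w ^ 2 / 2 := by field_simp; norm_num
        have := mul_lt_mul_of_pos_left h3 (by positivity : 0 < 2 * x)
        linarith
      have h5 : d ^ 2 ≤ w ^ 2 := by gcongr
      rw [le_div_iff₀ (by positivity)]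
      rw [mul_one_div, lt_div_iff₀ hN] at h4
      nlinarith
    set m := max (cOne μ ε₀ (j + 1)) (1 / ε₀) with hm
    have hne : ∀ l, ¬ bestMean μ - μ l ≤ gap μ j → gap μ (j + 1) ≤ bestMean μ - μ l := by
      intro l hl
      obtain ⟨a, ha, hla⟩ := exists_class μ l
      rw [hla] at hl ⊢
      have hj' : j ∈ Finset.Icc 1 (numClasses μ) := Finset.mem_Icc.2 ⟨hj.1, by omega⟩
      rw [gap_le_gap_iff μ ha hj'] at hl
      rw [Finset.mem_Icc] at ha
      exact gap_le_gap μ (by omega) (by omega) ha.2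
    -- Arms of gap at most Δ_j are undersampled throughout by `hgood`; when neither arm of the pair
    -- is of this kind, the suboptimal leader provides the threshold with `m`.
    set f : ℝ → ℝ := fun g => if g ≤ gap μ j then 4 * x / d ^ 2 else 4 * x * m ^ 2 with hf
    have := h.lt_of_undersampled hK (D := fun l => f (bestMean μ - μ l))
      (fun l => by simp only [hf]; split_ifs <;> positivity) hn (fun t ht htn => by
        simp only [hf]
        by_cases hB : bestMean μ - μ (B t) ≤ gap μ j
        · rw [if_pos hB]
          exact Or.inl ((hmono t htn _).trans (hgood _ hB))
        by_cases hC : bestMean μ - μ (C t) ≤ gap μ j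
        · rw [if_pos hC]
          exact Or.inr ((hmono t htn _).trans (hgood _ hC))
        rw [if_neg hB, if_neg hC]
        exact h.undersampled_of_leader hε ht hx (hA t ht htn.le) hgj1 (one_div_gap_le μ)
          (le_max_right _ _) (hne _ hB))
    rw [sum_comp_gap, sum_Icc_split _ (a := 1) (b := j) (by omega) (by omega)] at this
    have e1 : ∑ a ∈ Finset.Icc 1 j, (classCard μ a : ℝ) * f (gap μ a)
        = 4 * x * ((∑ a ∈ Finset.Icc 1 j, (classCard μ a : ℝ)) * (1 / d ^ 2)) := by
      rw [Finset.sum_mul, Finset.mul_sum]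
      refine Finset.sum_congr rfl fun a ha => ?_
      rw [Finset.mem_Icc] at ha
      rw [hf]
      simp only
      rw [if_pos (gap_le_gap μ ha.1 ha.2 (by omega))]
      ring
    have e2 : ∑ a ∈ Finset.Icc (j + 1) (numClasses μ), (classCard μ a : ℝ) * f (gap μ a)
        = 4 * x * ((∑ a ∈ Finset.Icc (j + 1) (numClasses μ), (classCard μ a : ℝ)) * m ^ 2) := by
      rw [Finset.sum_mul, Finset.mul_sum]
      refine Finset.sum_congr rfl fun a ha => ?_
      rw [Finset.mem_Icc] at ha
      rw [hf]
      simp only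
      rw [if_neg (not_le.2 (gap_lt_gap μ hj.1 (by omega) ha.2))]
      ring
    have h1 := (le_hTilde μ hε (i := i) (j := j)).trans (le_max_right (hBar μ ε₀ i j) _)
    rw [hjc] at h1
    rw [e1, e2] at this
    nlinarith

end Concentration

end EBTC

namespace EBTC

/-! ### Ville's inequality for mixtures -/

section MaximalInequality

variable {Ω : Type*} [mΩ : MeasurableSpace Ω] {P : Measure Ω} {𝓕 : Filtration ℕ mΩ}

/-- First-hit decomposition behind Ville's inequality. -/
theorem sum_setLIntegral_firstHit_le {Z : ℕ → Ω → ENNReal}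
    (hZ : ∀ r A, MeasurableSet[𝓕 r] A → ∫⁻ ω in A, Z (r + 1) ω ∂P ≤ ∫⁻ ω in A, Z r ω ∂P)
    {E : ℕ → Set Ω} (hE : ∀ r, MeasurableSet[𝓕 r] (E r)) (n : ℕ) :
    ∑ r ∈ Finset.range n, ∫⁻ ω in E r ∩ {ω | ∀ q < r, ω ∉ E q}, Z r ω ∂P ≤ ∫⁻ ω, Z 0 ω ∂P := by
  have hR : ∀ r, MeasurableSet[𝓕 r] {ω | ∀ q < r, ω ∉ E q} := by
    intro r
    have : {ω | ∀ q < r, ω ∉ E q} = ⋂ q, ⋂ (_ : q < r), (E q)ᶜ := by ext; simp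
    rw [this]
    exact MeasurableSet.iInter fun q => MeasurableSet.iInter fun hq =>
      (𝓕.mono hq.le _ (hE q)).compl
  -- Keeping the mass on the set not yet hit closes the induction: that set splits by `E n`, and the
  -- supermartingale step is applied on the remainder.
  suffices h : ∑ r ∈ Finset.range n, ∫⁻ ω in E r ∩ {ω | ∀ q < r, ω ∉ E q}, Z r ω ∂P
      + ∫⁻ ω in {ω | ∀ q < n, ω ∉ E q}, Z n ω ∂P ≤ ∫⁻ ω, Z 0 ω ∂P from le_self_add.trans h
  induction n with
  | zero => simp
  | succ n ih =>
    refine le_trans ?_ ih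
    rw [Finset.sum_range_succ, add_assoc]
    gcongr
    have hset : {ω | ∀ q < n + 1, ω ∉ E q} = {ω | ∀ q < n, ω ∉ E q} \ E n := by
      ext ω
      simp only [Set.mem_ofPred_eq, Set.mem_sdiff, Nat.lt_succ_iff_lt_or_eq]
      constructor
      · exact fun h => ⟨fun q hq => h q (Or.inl hq), h n (Or.inr rfl)⟩
      · rintro ⟨h1, h2⟩ q (hq | rfl)
        · exact h1 q hq
        · exact h2
    rw [← lintegral_inter_add_sdiff (Z n) {ω | ∀ q < n, ω ∉ E q} (𝓕.le n _ (hE n)),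
      Set.inter_comm, hset]
    exact add_le_add_right (hZ n _ ((hR n).diff (hE n))) _

/-- Maximal inequality for a mixture of nonnegative supermartingales started at `1`. -/
theorem mul_measure_exists_le_one [IsProbabilityMeasure P] {Λ : Type*} [MeasurableSpace Λ]
    {ρ : Measure Λ} [IsProbabilityMeasure ρ] {Z : Λ → ℕ → Ω → ENNReal}
    (hZm : ∀ r, Measurable fun p : Ω × Λ => Z p.2 r p.1) (hZ0 : ∀ l ω, Z l 0 ω = 1)
    (hZ : ∀ l r A, MeasurableSet[𝓕 r] A → ∫⁻ ω in A, Z l (r + 1) ω ∂P ≤ ∫⁻ ω in A, Z l r ω ∂P)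
    {E : ℕ → Set Ω} (hE : ∀ r, MeasurableSet[𝓕 r] (E r)) {w : ENNReal}
    (hw : ∀ r, ∀ ω ∈ E r, w ≤ ∫⁻ l, Z l r ω ∂ρ) (n : ℕ) :
    w * P {ω | ∃ r < n, ω ∈ E r} ≤ 1 := by
  set A : ℕ → Set Ω := fun r => E r ∩ {ω | ∀ q < r, ω ∉ E q} with hA
  have hsub : {ω | ∃ r < n, ω ∈ E r} ⊆ ⋃ r ∈ Finset.range n, A r := by
    classical
    rintro ω ⟨r, hr, hω⟩
    have hex : ∃ r, ω ∈ E r := ⟨r, hω⟩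
    simp only [Set.mem_iUnion, Finset.mem_range]
    exact ⟨Nat.find hex, (Nat.find_min' hex hω).trans_lt hr, Nat.find_spec hex,
      fun q hq => Nat.find_min hex hq⟩
  calc w * P {ω | ∃ r < n, ω ∈ E r}
      ≤ w * ∑ r ∈ Finset.range n, P (A r) := by
        gcongr
        exact (measure_mono hsub).trans (measure_biUnion_finset_le _ _)
    _ = ∑ r ∈ Finset.range n, ∫⁻ _ in A r, w ∂P := by simp [Finset.mul_sum]
    _ ≤ ∑ r ∈ Finset.range n, ∫⁻ ω in A r, ∫⁻ l, Z l r ω ∂ρ ∂P := by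
        refine Finset.sum_le_sum fun r _ => setLIntegral_mono ?_ fun ω hω => hw r ω hω.1
        exact (hZm r).lintegral_prod_right'
    -- The hitting sets do not depend on `l`, so after Tonelli the first-hit bound applies for each
    -- fixed `l`.
    _ = ∑ r ∈ Finset.range n, ∫⁻ l, ∫⁻ ω in A r, Z l r ω ∂P ∂ρ := by
        refine Finset.sum_congr rfl fun r _ => ?_
        exact lintegral_lintegral_swap (hZm r).aemeasurable
    _ = ∫⁻ l, ∑ r ∈ Finset.range n, ∫⁻ ω in A r, Z l r ω ∂P ∂ρ := by
        rw [lintegral_finsetSum]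
        intro r _
        exact (hZm r).lintegral_prod_left'
    _ ≤ ∫⁻ _, 1 ∂ρ := by
        refine lintegral_mono fun l => ?_
        refine (sum_setLIntegral_firstHit_le (hZ l) hE n).trans ?_
        simp [hZ0]
    _ = 1 := by simp

end MaximalInequality

/-! ### Gaussian mixtures of exponential weights -/

section GaussianMixture

/-- Completing the square turns the integrand into a constant times the Gaussian density of mean
s/(σ+N) and variance 1/(σ+N). -/
theorem lintegral_exp_gaussianReal {s N σ : ℝ} (hN : 0 ≤ N) (hσ : 0 < σ) :
    ∫⁻ l, ENNReal.ofReal (Real.exp (l * s - l ^ 2 * N / 2)) ∂(gaussianReal 0 (1 / σ).toNNReal)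
      = ENNReal.ofReal (√(σ / (σ + N)) * Real.exp (s ^ 2 / (2 * (N + σ)))) := by
  have hv : (1 / σ).toNNReal ≠ 0 := by simpa using hσ
  have hv' : (1 / (σ + N)).toNNReal ≠ 0 := by
    simp only [ne_eq, Real.toNNReal_eq_zero, not_le]; positivity
  rw [gaussianReal_of_var_ne_zero _ hv, lintegral_withDensity_eq_lintegral_mul _
    (measurable_gaussianPDF _ _) (by fun_prop)]
  have key : ∀ l, (gaussianPDF 0 (1 / σ).toNNReal * fun l =>
      ENNReal.ofReal (Real.exp (l * s - l ^ 2 * N / 2))) l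
      = ENNReal.ofReal (√(σ / (σ + N)) * Real.exp (s ^ 2 / (2 * (N + σ))))
        * gaussianPDF (s / (σ + N)) (1 / (σ + N)).toNNReal l := by
    intro l
    rw [Pi.mul_apply, gaussianPDF, gaussianPDF, ← ENNReal.ofReal_mul (gaussianPDFReal_nonneg _ _ _),
      ← ENNReal.ofReal_mul (by positivity), gaussianPDFReal, gaussianPDFReal,
      Real.coe_toNNReal _ (by positivity), Real.coe_toNNReal _ (by positivity)]
    congr 1
    have e1 : (√(2 * Real.pi * (1 / σ)))⁻¹
        = √(σ / (σ + N)) * (√(2 * Real.pi * (1 / (σ + N))))⁻¹ := by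
      rw [← Real.sqrt_inv, ← Real.sqrt_inv, ← Real.sqrt_mul (by positivity)]
      congr 1
      field_simp
    have e2 : Real.exp (-(l - 0) ^ 2 / (2 * (1 / σ))) * Real.exp (l * s - l ^ 2 * N / 2)
        = Real.exp (s ^ 2 / (2 * (N + σ)))
          * Real.exp (-(l - s / (σ + N)) ^ 2 / (2 * (1 / (σ + N)))) := by
      rw [← Real.exp_add, ← Real.exp_add]
      congr 1
      field_simp
      ring
    rw [e1]
    linear_combination (√(σ / (σ + N)) * (√(2 * Real.pi * (1 / (σ + N))))⁻¹) * e2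
  rw [lintegral_congr key, lintegral_const_mul _ (measurable_gaussianPDF _ _),
    lintegral_gaussianPDF_eq_one _ hv', mul_one]

/-- The prior precision ηa is tuned to the slice: ηa ≤ ηN controls the exponent and N ≤ ea controls
the prefactor. -/
theorem le_lintegral_exp_gaussianReal {s N a η : ℝ} (ha : 0 < a) (hη : 0 < η) (h1 : a ≤ N)
    (h2 : N ≤ Real.exp 1 * a) :
    ENNReal.ofReal (√(η / (η + Real.exp 1)) * Real.exp (s ^ 2 / (2 * N) / (1 + η)))
      ≤ ∫⁻ l, ENNReal.ofReal (Real.exp (l * s - l ^ 2 * N / 2))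
        ∂(gaussianReal 0 (1 / (η * a)).toNNReal) := by
  have hN : 0 < N := ha.trans_le h1
  rw [lintegral_exp_gaussianReal hN.le (by positivity)]
  refine ENNReal.ofReal_le_ofReal ?_
  gcongr ?_ * ?_
  · apply Real.sqrt_le_sqrt
    rw [div_le_div_iff₀ (by positivity) (by positivity)]
    nlinarith
  · apply Real.exp_le_exp.2
    rw [div_div]
    refine div_le_div_of_nonneg_left (by positivity) (by positivity) ?_
    nlinarith

end GaussianMixture

/-! ### Reward laws, exponential supermartingales and peeling -/

section Rewards

variable {K : ℕ} {Ω : Type*} [mΩ : MeasurableSpace Ω] {P : Measure Ω}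
  {ν : Fin K → Measure ℝ} {ε₀ β : ℝ} {𝓕 : Filtration ℕ mΩ} {I : ℕ → Ω → Fin K} {X : ℕ → Ω → ℝ}
  {B C : ℕ → Ω → Fin K}

theorem IsEBTC.measurable_reward' (h : IsEBTC P ν ε₀ β 𝓕 I X B C) (t : ℕ) :
    Measurable (X (t + 1)) :=
  (h.measurable_reward t).mono (𝓕.le _) le_rfl

theorem IsEBTC.measure_inter_preimage [IsProbabilityMeasure P]
    (h : IsEBTC P ν ε₀ β 𝓕 I X B C)
    (hν : ∀ k, IsProbabilityMeasure (ν k)) {t : ℕ} {k : Fin K} {A : Set Ω}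
    (hA : MeasurableSet[𝓕 t] A) (hAk : ∀ ω ∈ A, I (t + 1) ω = k) {s : Set ℝ}
    (hs : MeasurableSet s) : P (X (t + 1) ⁻¹' s ∩ A) = P A * ν k s := by
  have hA' : MeasurableSet A := 𝓕.le t A hA
  have hXs : MeasurableSet (X (t + 1) ⁻¹' s) := h.measurable_reward' t hs
  have h1 := setIntegral_condExp (μ := P) (m := 𝓕 t) (𝓕.le t)
    (f := (X (t + 1) ⁻¹' s).indicator fun _ => (1 : ℝ))
    ((integrable_const 1).indicator hXs) hA
  have h2 : ∫ ω in A, (P⟦X (t + 1) ⁻¹' s | 𝓕 t⟧) ω ∂P = ∫ _ in A, (ν k).real s ∂P := by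
    refine setIntegral_congr_ae hA' ?_
    filter_upwards [h.reward_law t s hs] with ω hω hωA
    rw [hω, hAk ω hωA]
  rw [h2, setIntegral_const, integral_indicator hXs, setIntegral_const, smul_eq_mul, smul_eq_mul,
    mul_one] at h1
  rw [measureReal_restrict_apply hXs] at h1
  have h3 : (P (X (t + 1) ⁻¹' s ∩ A)).toReal = (P A * ν k s).toReal := by
    rw [ENNReal.toReal_mul]; exact h1.symm
  exact (ENNReal.toReal_eq_toReal_iff' (by finiteness) (by finiteness)).1 h3

theorem IsEBTC.setLIntegral_reward [IsProbabilityMeasure P]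
    (h : IsEBTC P ν ε₀ β 𝓕 I X B C)
    (hν : ∀ k, IsProbabilityMeasure (ν k)) {t : ℕ} {k : Fin K} {A : Set Ω}
    (hA : MeasurableSet[𝓕 t] A) (hAk : ∀ ω ∈ A, I (t + 1) ω = k) {g : ℝ → ENNReal}
    (hg : Measurable g) : ∫⁻ ω in A, g (X (t + 1) ω) ∂P = P A * ∫⁻ y, g y ∂(ν k) := by
  have hX := h.measurable_reward' t
  have hmap : (P.restrict A).map (X (t + 1)) = P A • ν k := by
    ext s hs
    rw [Measure.map_apply hX hs, Measure.restrict_apply (hX hs),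
      h.measure_inter_preimage hν hA hAk hs]
    simp
  rw [← lintegral_map hg hX, hmap, lintegral_smul_measure, smul_eq_mul]

/-- On an event of the past where arm `k` is chosen, the next reward has law `ν k` independently of
the past. Monotone approximation extends this from indicators to all nonnegative weights `W`. -/
theorem IsEBTC.setLIntegral_mul_reward [IsProbabilityMeasure P]
    (h : IsEBTC P ν ε₀ β 𝓕 I X B C)
    (hν : ∀ k, IsProbabilityMeasure (ν k)) {t : ℕ} {k : Fin K} {g : ℝ → ENNReal}
    (hg : Measurable g) {W : Ω → ENNReal} (hW : Measurable[𝓕 t] W) {A : Set Ω}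
    (hA : MeasurableSet[𝓕 t] A) (hAk : ∀ ω ∈ A, I (t + 1) ω = k) :
    ∫⁻ ω in A, W ω * g (X (t + 1) ω) ∂P = (∫⁻ ω in A, W ω ∂P) * ∫⁻ y, g y ∂(ν k) := by
  have hgX : Measurable fun ω => g (X (t + 1) ω) := hg.comp (h.measurable_reward' t)
  refine @Measurable.ennreal_induction Ω (𝓕 t) (fun W => ∫⁻ ω in A, W ω * g (X (t + 1) ω) ∂P
    = (∫⁻ ω in A, W ω ∂P) * ∫⁻ y, g y ∂(ν k)) ?_ ?_ ?_ W hW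
  · intro c s hs
    have hs' : MeasurableSet s := 𝓕.le t s hs
    have e : (fun ω => s.indicator (fun _ => c) ω * g (X (t + 1) ω))
        = s.indicator fun ω => c * g (X (t + 1) ω) := by
      ext ω
      by_cases hω : ω ∈ s <;> simp [hω]
    rw [e, setLIntegral_indicator hs', setLIntegral_indicator hs', lintegral_const_mul _ hgX,
      h.setLIntegral_reward hν (hs.inter hA) (fun ω hω => hAk ω hω.2) hg, setLIntegral_const,
      mul_assoc]
  · intro f g' _ hf hg' hf' hg''
    have hf0 : Measurable f := hf.mono (𝓕.le t) le_rfl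
    simp only [Pi.add_apply, add_mul]
    rw [lintegral_add_left (f := fun ω => f ω * g (X (t + 1) ω)) (hf0.mul hgX),
      lintegral_add_left hf0, hf', hg'', add_mul]
  · intro f hf hmono hf'
    have hf0 : ∀ n, Measurable (f n) := fun n => (hf n).mono (𝓕.le t) le_rfl
    simp only [ENNReal.iSup_mul]
    rw [lintegral_iSup (f := fun n ω => f n ω * g (X (t + 1) ω))
      (fun n => (hf0 n).mul hgX)
      (fun a b hab ω => mul_le_mul_left (hmono hab ω) _), lintegral_iSup hf0 hmono,
      ENNReal.iSup_mul]
    exact iSup_congr hf'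

theorem IsEBTC.setLIntegral_mul_reward_le [IsProbabilityMeasure P]
    (h : IsEBTC P ν ε₀ β 𝓕 I X B C)
    (hν : ∀ k, IsProbabilityMeasure (ν k)) {t : ℕ} {g : Fin K → ℝ → ENNReal}
    (hg : ∀ k, Measurable (g k)) (hg1 : ∀ k, ∫⁻ y, g k y ∂(ν k) ≤ 1) {W : Ω → ENNReal}
    (hW : Measurable[𝓕 t] W) {A : Set Ω} (hA : MeasurableSet[𝓕 t] A) :
    ∫⁻ ω in A, W ω * g (I (t + 1) ω) (X (t + 1) ω) ∂P ≤ ∫⁻ ω in A, W ω ∂P := by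
  have hAk : ∀ k, MeasurableSet[𝓕 t] (A ∩ I (t + 1) ⁻¹' {k}) := fun k =>
    hA.inter (h.measurable_arm t (measurableSet_singleton k))
  have hU : A = ⋃ k, A ∩ I (t + 1) ⁻¹' {k} := by ext; simp
  have hsplit : ∀ f : Ω → ENNReal, ∫⁻ ω in A, f ω ∂P
      = ∑ k, ∫⁻ ω in A ∩ I (t + 1) ⁻¹' {k}, f ω ∂P := by
    intro f
    conv_lhs => rw [hU]
    rw [lintegral_iUnion (fun k => 𝓕.le t _ (hAk k)), tsum_fintype]
    intro a b hab
    refine Set.disjoint_left.2 fun ω h1 h2 => hab ?_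
    exact (h1.2 : I (t + 1) ω = a).symm.trans h2.2
  rw [hsplit, hsplit]
  refine Finset.sum_le_sum fun k _ => ?_
  calc ∫⁻ ω in A ∩ I (t + 1) ⁻¹' {k}, W ω * g (I (t + 1) ω) (X (t + 1) ω) ∂P
      = ∫⁻ ω in A ∩ I (t + 1) ⁻¹' {k}, W ω * g k (X (t + 1) ω) ∂P := by
        refine setLIntegral_congr_fun (𝓕.le t _ (hAk k)) fun ω hω => ?_
        have : I (t + 1) ω = k := hω.2
        simp only [this]
    _ = (∫⁻ ω in A ∩ I (t + 1) ⁻¹' {k}, W ω ∂P) * ∫⁻ y, g k y ∂(ν k) :=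
        h.setLIntegral_mul_reward hν (hg k) hW (hAk k) fun ω hω => hω.2
    _ ≤ (∫⁻ ω in A ∩ I (t + 1) ⁻¹' {k}, W ω ∂P) * 1 := by gcongr; exact hg1 k
    _ = _ := mul_one _

/-- The sum of the centred rewards of arm `i` before time `n`. -/
noncomputable def devSum (μ : Fin K → ℝ) (I : ℕ → Fin K) (X : ℕ → ℝ) (n : ℕ) (i : Fin K) : ℝ :=
  ∑ t ∈ Finset.Ico 1 n, if I t = i then X t - μ i else 0

theorem pulls_cast (I : ℕ → Fin K) (n : ℕ) (i : Fin K) :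
    (pulls I n i : ℝ) = ∑ t ∈ Finset.Ico 1 n, if I t = i then 1 else 0 := by
  rw [pulls, Finset.card_filter]
  push_cast
  rfl

theorem devSum_eq {μ : Fin K → ℝ} {I : ℕ → Fin K} {X : ℕ → ℝ} {n : ℕ} {i : Fin K}
    (hN : 0 < (pulls I n i : ℝ)) :
    devSum μ I X n i = pulls I n i * (empMean I X n i - μ i) := by
  have : devSum μ I X n i
      = ∑ t ∈ (Finset.Ico 1 n).filter (fun t => I t = i), X t - pulls I n i * μ i := by
    rw [devSum, ← Finset.sum_filter, Finset.sum_sub_distrib, Finset.sum_const, nsmul_eq_mul, pulls]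
  rw [this, empMean]
  field_simp

theorem IsEBTC.measurable_arm_of_lt (h : IsEBTC P ν ε₀ β 𝓕 I X B C) {r s : ℕ}
    (hs : s ∈ Finset.Ico 1 (r + 1)) : Measurable[𝓕 r] (I s) := by
  rw [Finset.mem_Ico] at hs
  obtain ⟨q, rfl⟩ := Nat.exists_eq_succ_of_ne_zero (by omega : s ≠ 0)
  exact (h.measurable_arm q).mono (𝓕.mono (by omega)) le_rfl

theorem IsEBTC.measurable_reward_of_lt (h : IsEBTC P ν ε₀ β 𝓕 I X B C) {r s : ℕ}
    (hs : s ∈ Finset.Ico 1 (r + 1)) : Measurable[𝓕 r] (X s) := by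
  rw [Finset.mem_Ico] at hs
  obtain ⟨q, rfl⟩ := Nat.exists_eq_succ_of_ne_zero (by omega : s ≠ 0)
  exact (h.measurable_reward q).mono (𝓕.mono (by omega)) le_rfl

theorem IsEBTC.measurable_pulls (h : IsEBTC P ν ε₀ β 𝓕 I X B C) (r : ℕ) (i : Fin K) :
    Measurable[𝓕 r] fun ω => (pulls (fun t => I t ω) (r + 1) i : ℝ) := by
  simp only [pulls_cast]
  exact Finset.measurable_fun_sum _ fun s hs => Measurable.ite
    (h.measurable_arm_of_lt hs (measurableSet_singleton i)) measurable_const measurable_const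

theorem IsEBTC.measurable_devSum (h : IsEBTC P ν ε₀ β 𝓕 I X B C) (μ : Fin K → ℝ) (r : ℕ)
    (i : Fin K) :
    Measurable[𝓕 r] fun ω => devSum μ (fun t => I t ω) (fun t => X t ω) (r + 1) i := by
  simp only [devSum]
  exact Finset.measurable_fun_sum _ fun s hs => Measurable.ite
    (h.measurable_arm_of_lt hs (measurableSet_singleton i))
    ((h.measurable_reward_of_lt hs).sub_const _) measurable_const

/-- Exponential weight of arm `i` along a trajectory. -/
noncomputable def expWeight (μ : Fin K → ℝ) (i : Fin K) (l : ℝ) (I : ℕ → Fin K) (X : ℕ → ℝ) (n : ℕ) :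
    ENNReal :=
  ENNReal.ofReal (Real.exp (l * devSum μ I X n i - l ^ 2 * pulls I n i / 2))

theorem expWeight_succ {μ : Fin K → ℝ} {i : Fin K} {l : ℝ} {I : ℕ → Fin K} {X : ℕ → ℝ} {n : ℕ}
    (hn : 1 ≤ n) : expWeight μ i l I X (n + 1) = expWeight μ i l I X n *
      if I n = i then ENNReal.ofReal (Real.exp (l * (X n - μ i) - l ^ 2 / 2)) else 1 := by
  have e1 : devSum μ I X (n + 1) i = devSum μ I X n i + if I n = i then X n - μ i else 0 :=
    Finset.sum_Ico_succ_top hn _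
  have e2 : (pulls I (n + 1) i : ℝ) = pulls I n i + if I n = i then 1 else 0 := by
    rw [pulls_cast, pulls_cast]
    exact Finset.sum_Ico_succ_top hn _
  rw [expWeight, expWeight, e1, e2]
  split_ifs
  · rw [← ENNReal.ofReal_mul (by positivity), ← Real.exp_add]
    congr 2
    ring
  · simp

theorem lintegral_exp_le_one {ρ : Measure ℝ} [IsProbabilityMeasure ρ] (h : IsOneSubGaussian ρ)
    (l : ℝ) :
    ∫⁻ y, ENNReal.ofReal (Real.exp (l * (y - ∫ z, z ∂ρ) - l ^ 2 / 2)) ∂ρ ≤ 1 := by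
  have h1 := h.mgf_le l
  have h2 := h.integrable_exp_mul l
  simp only [Real.exp_sub]
  rw [← ofReal_integral_eq_lintegral_ofReal (h2.div_const _)
    (Filter.Eventually.of_forall fun y => by positivity), integral_div]
  rw [ENNReal.ofReal_le_one, div_le_one (by positivity)]
  simpa [mgf] using h1

/-- As the arms are distinct, a round changes at most one of the two factors, and sub-Gaussianity
bounds the mean of that change by 1. The two parameters can therefore be chosen, and later mixed,
independently. -/
theorem IsEBTC.setLIntegral_expWeight_le [IsProbabilityMeasure P]
    (h : IsEBTC P ν ε₀ β 𝓕 I X B C)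
    (hν : ∀ k, IsProbabilityMeasure (ν k)) (hsub : ∀ k, IsOneSubGaussian (ν k)) {i k : Fin K}
    (hik : i ≠ k) (l : ℝ × ℝ) (r : ℕ) {A : Set Ω} (hA : MeasurableSet[𝓕 r] A) :
    ∫⁻ ω in A, expWeight (armMean ν) i l.1 (fun t => I t ω) (fun t => X t ω) (r + 1 + 1)
        * expWeight (armMean ν) k l.2 (fun t => I t ω) (fun t => X t ω) (r + 1 + 1) ∂P
      ≤ ∫⁻ ω in A, expWeight (armMean ν) i l.1 (fun t => I t ω) (fun t => X t ω) (r + 1)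
        * expWeight (armMean ν) k l.2 (fun t => I t ω) (fun t => X t ω) (r + 1) ∂P := by
  set g : Fin K → ℝ → ENNReal := fun a y =>
    (if a = i then ENNReal.ofReal (Real.exp (l.1 * (y - armMean ν i) - l.1 ^ 2 / 2)) else 1) *
    (if a = k then ENNReal.ofReal (Real.exp (l.2 * (y - armMean ν k) - l.2 ^ 2 / 2)) else 1)
    with hg
  have hgm : ∀ a, Measurable (g a) := by
    intro a
    simp only [hg]
    split_ifs <;> fun_prop
  have hg1 : ∀ a, ∫⁻ y, g a y ∂(ν a) ≤ 1 := by
    intro a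
    by_cases hai : a = i
    · subst hai
      simpa [hg, hik, armMean] using lintegral_exp_le_one (hsub a) l.1
    · by_cases hak : a = k
      · subst hak
        simpa [hg, hai, armMean] using lintegral_exp_le_one (hsub a) l.2
      · simp [hg, hai, hak]
  have hW : Measurable[𝓕 r] fun ω =>
      expWeight (armMean ν) i l.1 (fun t => I t ω) (fun t => X t ω) (r + 1)
        * expWeight (armMean ν) k l.2 (fun t => I t ω) (fun t => X t ω) (r + 1) := by
    have h1 := h.measurable_devSum (armMean ν) r i
    have h2 := h.measurable_devSum (armMean ν) r k
    have h3 := h.measurable_pulls r i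
    have h4 := h.measurable_pulls r k
    simp only [expWeight]
    exact (((h1.const_mul _).sub ((h3.const_mul _).div_const _)).exp.ennreal_ofReal).mul
      (((h2.const_mul _).sub ((h4.const_mul _).div_const _)).exp.ennreal_ofReal)
  refine le_trans (le_of_eq ?_) (h.setLIntegral_mul_reward_le hν hgm hg1 hW hA)
  refine lintegral_congr fun ω => ?_
  rw [expWeight_succ (n := r + 1) (by omega), expWeight_succ (n := r + 1) (by omega)]
  simp only [hg]
  rw [mul_mul_mul_comm]

/-- Joint deviation inequality for two arms whose numbers of pulls are known up to a factor `e`. -/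
theorem IsEBTC.measure_deviation_le [IsProbabilityMeasure P]
    (h : IsEBTC P ν ε₀ β 𝓕 I X B C)
    (hν : ∀ k, IsProbabilityMeasure (ν k)) (hsub : ∀ k, IsOneSubGaussian (ν k)) {i k : Fin K}
    (hik : i ≠ k) {x a b : ℝ} (hx : 1 < x) (ha : 0 < a) (hb : 0 < b) (n : ℕ) :
    P {ω | ∃ r < n,
      (a ≤ pulls (fun t => I t ω) (r + 1) i ∧
        (pulls (fun t => I t ω) (r + 1) i : ℝ) ≤ Real.exp 1 * a) ∧
      (b ≤ pulls (fun t => I t ω) (r + 1) k ∧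
        (pulls (fun t => I t ω) (r + 1) k : ℝ) ≤ Real.exp 1 * b) ∧
      x ≤ devSum (armMean ν) (fun t => I t ω) (fun t => X t ω) (r + 1) i ^ 2
          / (2 * pulls (fun t => I t ω) (r + 1) i)
        + devSum (armMean ν) (fun t => I t ω) (fun t => X t ω) (r + 1) k ^ 2
          / (2 * pulls (fun t => I t ω) (r + 1) k)}
      ≤ ENNReal.ofReal (Real.exp 2 * (x * Real.exp (-x))) := by
  -- This gives x/(1+η) = x - 1 and 1/w = (1 + e(x-1))·exp(1-x) ≤ e²·x·exp(-x). The two arms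
  -- contribute √(η/(η+e)) each, whence the prefactor of `w`.
  set η := 1 / (x - 1) with hη
  have hx1 : 0 < x - 1 := by linarith
  have hη0 : 0 < η := by positivity
  set w := η / (η + Real.exp 1) * Real.exp (x / (1 + η)) with hw
  have hw0 : 0 < w := by positivity
  set E : ℕ → Set Ω := fun r => {ω |
      (a ≤ pulls (fun t => I t ω) (r + 1) i ∧
        (pulls (fun t => I t ω) (r + 1) i : ℝ) ≤ Real.exp 1 * a) ∧
      (b ≤ pulls (fun t => I t ω) (r + 1) k ∧
        (pulls (fun t => I t ω) (r + 1) k : ℝ) ≤ Real.exp 1 * b) ∧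
      x ≤ devSum (armMean ν) (fun t => I t ω) (fun t => X t ω) (r + 1) i ^ 2
          / (2 * pulls (fun t => I t ω) (r + 1) i)
        + devSum (armMean ν) (fun t => I t ω) (fun t => X t ω) (r + 1) k ^ 2
          / (2 * pulls (fun t => I t ω) (r + 1) k)} with hE
  have hEm : ∀ r, MeasurableSet[𝓕 r] (E r) := by
    intro r
    have h1 := h.measurable_devSum (armMean ν) r i
    have h2 := h.measurable_devSum (armMean ν) r k
    have h3 := h.measurable_pulls r i
    have h4 := h.measurable_pulls r k
    refine MeasurableSet.inter (MeasurableSet.inter ?_ ?_) (MeasurableSet.inter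
      (MeasurableSet.inter ?_ ?_) ?_)
    · exact measurableSet_le measurable_const h3
    · exact measurableSet_le h3 measurable_const
    · exact measurableSet_le measurable_const h4
    · exact measurableSet_le h4 measurable_const
    · exact measurableSet_le measurable_const
        (((h1.pow_const 2).div (h3.const_mul _)).add ((h2.pow_const 2).div (h4.const_mul _)))
  have hmain := mul_measure_exists_le_one (P := P) (𝓕 := 𝓕)
    (ρ := (gaussianReal 0 (1 / (η * a)).toNNReal).prod (gaussianReal 0 (1 / (η * b)).toNNReal))
    (Z := fun l r ω => expWeight (armMean ν) i l.1 (fun t => I t ω) (fun t => X t ω) (r + 1)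
        * expWeight (armMean ν) k l.2 (fun t => I t ω) (fun t => X t ω) (r + 1))
    (E := E) (w := ENNReal.ofReal w) (fun r => by
      have h1 := (h.measurable_devSum (armMean ν) r i).mono (𝓕.le r) le_rfl
      have h2 := (h.measurable_devSum (armMean ν) r k).mono (𝓕.le r) le_rfl
      have h3 := (h.measurable_pulls r i).mono (𝓕.le r) le_rfl
      have h4 := (h.measurable_pulls r k).mono (𝓕.le r) le_rfl
      have hfst : Measurable fun p : Ω × ℝ × ℝ => p.1 := measurable_fst
      have h1' := h1.comp hfst
      have h2' := h2.comp hfst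
      have h3' := h3.comp hfst
      have h4' := h4.comp hfst
      have hl1 : Measurable fun p : Ω × ℝ × ℝ => p.2.1 := by fun_prop
      have hl2 : Measurable fun p : Ω × ℝ × ℝ => p.2.2 := by fun_prop
      simp only [expWeight]
      exact (((hl1.mul h1').sub (((hl1.pow_const 2).mul h3').div_const 2)).exp.ennreal_ofReal).mul
        (((hl2.mul h2').sub (((hl2.pow_const 2).mul h4').div_const 2)).exp.ennreal_ofReal))
    -- At index 0 the counts run over rounds before round 1, so both exponents vanish.
    (fun l ω => by simp [expWeight, devSum, pulls])
    (fun l r A hA => h.setLIntegral_expWeight_le hν hsub hik l r hA) hEm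
    (fun r ω hω => by
      obtain ⟨⟨h1, h2⟩, ⟨h3, h4⟩, h5⟩ := hω
      rw [lintegral_prod_mul (f := fun l => expWeight (armMean ν) i l (fun t => I t ω)
          (fun t => X t ω) (r + 1))
        (g := fun l => expWeight (armMean ν) k l (fun t => I t ω) (fun t => X t ω) (r + 1))
        (by simp only [expWeight]; fun_prop) (by simp only [expWeight]; fun_prop)]
      refine le_trans ?_ (mul_le_mul' (le_lintegral_exp_gaussianReal ha hη0 h1 h2)
        (le_lintegral_exp_gaussianReal hb hη0 h3 h4))
      rw [← ENNReal.ofReal_mul (by positivity), mul_mul_mul_comm,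
        Real.mul_self_sqrt (by positivity), ← Real.exp_add, ← add_div]
      refine ENNReal.ofReal_le_ofReal ?_
      rw [hw]
      gcongr) n
  have hinv : (ENNReal.ofReal w)⁻¹ ≤ ENNReal.ofReal (Real.exp 2 * (x * Real.exp (-x))) := by
    rw [← ENNReal.ofReal_inv_of_pos hw0]
    refine ENNReal.ofReal_le_ofReal ?_
    have e1 : x / (1 + η) = x - 1 := by rw [hη]; field_simp; ring
    have e2 : η / (η + Real.exp 1) = (1 + Real.exp 1 * (x - 1))⁻¹ := by rw [hη]; field_simp
    have e3 : Real.exp 2 * (x * Real.exp (-x)) = (Real.exp 1 * x) * (Real.exp (x - 1))⁻¹ := by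
      rw [← Real.exp_neg, mul_left_comm, ← Real.exp_add, mul_right_comm, ← Real.exp_add, mul_comm]
      ring_nf
    rw [hw, e1, e2, e3, mul_inv, inv_inv]
    have : 1 ≤ Real.exp 1 := Real.one_le_exp (by norm_num)
    gcongr
    linarith
  refine le_trans ?_ hinv
  rw [ENNReal.le_inv_iff_mul_le, mul_comm]
  exact hmain

/-- All empirical means are accurate up to time `n` with large probability. -/
theorem IsEBTC.measure_not_accurate_le [IsProbabilityMeasure P]
    (h : IsEBTC P ν ε₀ β 𝓕 I X B C)
    (hν : ∀ k, IsProbabilityMeasure (ν k)) (hsub : ∀ k, IsOneSubGaussian (ν k)) {x : ℝ}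
    (hx : 1 < x) {n : ℕ} (hn : 1 ≤ n) :
    P {ω | ∃ t, K < t ∧ t ≤ n ∧
      ¬ Accurate (armMean ν) x (fun t => I t ω) (fun t => X t ω) t}
      ≤ ENNReal.ofReal ((K : ℝ) ^ 2 * Real.exp 2 * (2 + Real.log n) ^ 2
          * (x * Real.exp (-x))) := by
  classical
  -- Counts lie between 1 and n, so the slices [e^u, e^{u+1}] with u < L cover them.
  set L := ⌊Real.log n⌋₊ + 1 with hL
  set F : (Fin K × Fin K) × (ℕ × ℕ) → Set Ω := fun p => {ω | ∃ r < n,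
      (Real.exp p.2.1 ≤ pulls (fun t => I t ω) (r + 1) p.1.1 ∧
        (pulls (fun t => I t ω) (r + 1) p.1.1 : ℝ) ≤ Real.exp 1 * Real.exp p.2.1) ∧
      (Real.exp p.2.2 ≤ pulls (fun t => I t ω) (r + 1) p.1.2 ∧
        (pulls (fun t => I t ω) (r + 1) p.1.2 : ℝ) ≤ Real.exp 1 * Real.exp p.2.2) ∧
      x ≤ devSum (armMean ν) (fun t => I t ω) (fun t => X t ω) (r + 1) p.1.1 ^ 2
          / (2 * pulls (fun t => I t ω) (r + 1) p.1.1)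
        + devSum (armMean ν) (fun t => I t ω) (fun t => X t ω) (r + 1) p.1.2 ^ 2
          / (2 * pulls (fun t => I t ω) (r + 1) p.1.2)} with hF
  set S := (Finset.univ : Finset (Fin K)).offDiag ×ˢ (Finset.range L ×ˢ Finset.range L) with hS
  have hsubset : ∀ᵐ ω ∂P, ω ∈ {ω | ∃ t, K < t ∧ t ≤ n ∧
      ¬ Accurate (armMean ν) x (fun t => I t ω) (fun t => X t ω) t} → ω ∈ ⋃ p ∈ S, F p := by
    filter_upwards [h.run] with ω hrun
    rintro ⟨t, hKt, htn, hacc⟩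
    simp only [Accurate, not_forall, not_lt] at hacc
    obtain ⟨i, k, hik, hdev⟩ := hacc
    obtain ⟨r, rfl⟩ := Nat.exists_eq_succ_of_ne_zero (by omega : t ≠ 0)
    have hslice : ∀ j, ∃ u < L, Real.exp u ≤ pulls (fun t => I t ω) (r + 1) j ∧
        (pulls (fun t => I t ω) (r + 1) j : ℝ) ≤ Real.exp 1 * Real.exp u := by
      intro j
      have hp := hrun.pulls_pos hKt j
      have hp1 : (1 : ℝ) ≤ pulls (fun t => I t ω) (r + 1) j := by
        exact_mod_cast hrun.one_le_pulls hKt j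
      have hpn : (pulls (fun t => I t ω) (r + 1) j : ℝ) ≤ n := by
        exact_mod_cast (pulls_le _ _ _).trans (by omega : r + 1 - 1 ≤ n)
      generalize (pulls (fun t => I t ω) (r + 1) j : ℝ) = N at hp hp1 hpn ⊢
      refine ⟨⌊Real.log N⌋₊, ?_, ?_, ?_⟩
      · rw [hL, Nat.lt_succ_iff]
        exact Nat.floor_le_floor (Real.log_le_log hp hpn)
      · rw [← Real.le_log_iff_exp_le hp]
        exact Nat.floor_le (Real.log_nonneg hp1)
      · rw [← Real.exp_add, ← Real.log_le_iff_le_exp hp]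
        have := Nat.lt_floor_add_one (Real.log N)
        linarith
    obtain ⟨u, hu, hu'⟩ := hslice i
    obtain ⟨v, hv, hv'⟩ := hslice k
    simp only [Set.mem_iUnion]
    refine ⟨((i, k), (u, v)), by simp [hS, hik, hu, hv], r, by omega, hu', hv', ?_⟩
    have hNi := hrun.pulls_pos hKt i
    have hNk := hrun.pulls_pos hKt k
    simp only
    rw [devSum_eq hNi, devSum_eq hNk]
    have e : ∀ N y : ℝ, 0 < N → (N * y) ^ 2 / (2 * N) = N * y ^ 2 / 2 := by
      intro N y hN
      field_simp
    rw [e _ _ hNi, e _ _ hNk]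
    simp only [Nat.succ_eq_add_one] at hdev
    linarith
  have hlog : 0 ≤ Real.log n := Real.log_nonneg (by exact_mod_cast hn)
  have hLle : (L : ℝ) ≤ 2 + Real.log n := by
    have := Nat.floor_le hlog
    rw [hL]
    push_cast
    linarith
  have hcard : (S.card : ℝ) ≤ (K : ℝ) ^ 2 * (2 + Real.log n) ^ 2 := by
    rw [hS, Finset.card_product, Finset.card_product, Finset.offDiag_card, Finset.card_range,
      Finset.card_univ, Fintype.card_fin]
    push_cast
    have h1 : ((K * K - K : ℕ) : ℝ) ≤ (K : ℝ) ^ 2 := by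
      rw [sq, ← Nat.cast_mul]
      exact Nat.cast_le.2 (Nat.sub_le _ _)
    rw [← sq (L : ℝ)]
    exact mul_le_mul h1 (by gcongr) (by positivity) (by positivity)
  calc P {ω | ∃ t, K < t ∧ t ≤ n ∧
        ¬ Accurate (armMean ν) x (fun t => I t ω) (fun t => X t ω) t}
      ≤ P (⋃ p ∈ S, F p) := measure_mono_ae hsubset
    _ ≤ ∑ p ∈ S, P (F p) := measure_biUnion_finset_le _ _
    _ ≤ ∑ _p ∈ S, ENNReal.ofReal (Real.exp 2 * (x * Real.exp (-x))) := by
        refine Finset.sum_le_sum fun p hp => ?_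
        have hne : p.1.1 ≠ p.1.2 := by
          rw [hS, Finset.mem_product, Finset.mem_offDiag] at hp
          exact hp.1.2.2
        exact h.measure_deviation_le hν hsub hne hx (Real.exp_pos _) (Real.exp_pos _) n
    _ = ENNReal.ofReal (S.card * (Real.exp 2 * (x * Real.exp (-x)))) := by
        rw [Finset.sum_const, nsmul_eq_mul, ENNReal.ofReal_mul (p := (S.card : ℝ)) (by positivity),
          ENNReal.ofReal_natCast]
    _ ≤ _ := by
        refine ENNReal.ofReal_le_ofReal ?_
        calc S.card * (Real.exp 2 * (x * Real.exp (-x)))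
            ≤ ((K : ℝ) ^ 2 * (2 + Real.log n) ^ 2) * (Real.exp 2 * (x * Real.exp (-x))) := by
              gcongr
          _ = _ := by ring

end Rewards

end EBTC

namespace EBTC

/-! ### Tail probabilities and expected regret -/

section Regret

variable {K : ℕ} {Ω : Type*} [mΩ : MeasurableSpace Ω] {P : Measure Ω} [IsProbabilityMeasure P]
  {ν : Fin K → Measure ℝ} {ε₀ : ℝ} {𝓕 : Filtration ℕ mΩ} {I : ℕ → Ω → Fin K} {X : ℕ → Ω → ℝ}
  {B C : ℕ → Ω → Fin K}

theorem exp_neg_pFun {x : ℝ} (hx : 0 < x) : Real.exp (-pFun x) = x * Real.exp (-x) := by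
  rw [pFun, neg_sub, sub_eq_add_neg, Real.exp_add, Real.exp_log hx]

theorem complexity_pos (μ : Fin K → ℝ) (hK : 0 < K) (hε : 0 < ε₀) {i : ℕ} (h1 : 1 ≤ i)
    (hi : i + 1 ≤ numClasses μ) : 0 < complexity μ ε₀ i := by
  have hg := gap_pos μ hK (by omega) hi
  have hK' : (0 : ℝ) < K := by exact_mod_cast hK
  exact lt_of_lt_of_le (by positivity) (le_complexity μ hK hε h1 hi)

theorem lt_of_five_mul_sq_lt (hK : 2 ≤ K) {n : ℕ} (hn : 5 * (K : ℝ) ^ 2 / 2 < n) : K < n := by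
  have hK' : (2 : ℝ) ≤ K := by exact_mod_cast hK
  have : (K : ℝ) < n := by nlinarith
  exact_mod_cast this

/-- Probability that the recommended arm is not in the best `i` classes. -/
theorem IsEBTC.measureReal_gap_le (h : IsEBTC P ν ε₀ (1 / 2) 𝓕 I X B C) (hK : 2 ≤ K)
    (hε : 0 < ε₀) (hν : ∀ k, IsProbabilityMeasure (ν k)) (hsub : ∀ k, IsOneSubGaussian (ν k))
    {n : ℕ} (hn : 5 * (K : ℝ) ^ 2 / 2 < n) {i : ℕ} (h1 : 1 ≤ i)
    (hi : i + 1 ≤ numClasses (armMean ν)) :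
    P.real {ω | gap (armMean ν) (i + 1) ≤ bestMean (armMean ν) - armMean ν (B n ω)}
      ≤ (K : ℝ) ^ 2 * Real.exp 2 * (2 + Real.log n) ^ 2 * Real.exp (-pFun
        (max 1 ((n - 5 * (K : ℝ) ^ 2 / 2) / (8 * complexity (armMean ν) ε₀ i)))) := by
  set μ := armMean ν with hμ
  have hKn := lt_of_five_mul_sq_lt hK hn
  have hH := complexity_pos μ (by omega) hε h1 hi
  set x := (n - 5 * (K : ℝ) ^ 2 / 2) / (8 * complexity μ ε₀ i) with hx
  have hlog : 0 ≤ Real.log n := Real.log_nonneg (by exact_mod_cast (by omega : 1 ≤ n))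
  have hK' : (2 : ℝ) ≤ K := by exact_mod_cast hK
  -- For x ≤ 1 the right side is K²·e·(2 + log n)² ≥ 1, so the bound is trivial; the deviation
  -- inequality needs x > 1.
  rcases le_or_gt x 1 with hx1 | hx1
  · rw [max_eq_left hx1, exp_neg_pFun one_pos]
    refine measureReal_le_one.trans ?_
    have e : (K : ℝ) ^ 2 * Real.exp 2 * (2 + Real.log n) ^ 2 * (1 * Real.exp (-1))
        = (K : ℝ) ^ 2 * Real.exp 1 * (2 + Real.log n) ^ 2 := by
      rw [one_mul, mul_right_comm, mul_assoc _ (Real.exp 2), ← Real.exp_add]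
      norm_num
    rw [e]
    have h2 : 1 ≤ Real.exp 1 := Real.one_le_exp (by norm_num)
    have h3 : 1 ≤ (K : ℝ) ^ 2 := by nlinarith
    have h4 : 1 ≤ (2 + Real.log n) ^ 2 := by nlinarith
    exact one_le_mul_of_one_le_of_one_le (one_le_mul_of_one_le_of_one_le h3 h2) h4
  · rw [max_eq_right hx1.le, exp_neg_pFun (by linarith)]
    refine ENNReal.toReal_le_of_le_ofReal (by positivity) ?_
    refine le_trans (measure_mono_ae ?_) (h.measure_not_accurate_le hν hsub hx1 (by omega))
    filter_upwards [h.run] with ω hrun hbad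
    by_contra hacc
    refine absurd hbad (not_le.2 (hrun.regret_lt_gap hε hK hKn (zero_lt_one.trans hx1) ?_ h1 hi ?_))
    · intro t hKt htn
      by_contra hc
      exact hacc ⟨t, hKt, htn, hc⟩
    · have : 8 * x * complexity μ ε₀ i = n - 5 * (K : ℝ) ^ 2 / 2 := by
        rw [hx]; field_simp
      linarith

theorem IsEBTC.integral_regret_le (h : IsEBTC P ν ε₀ (1 / 2) 𝓕 I X B C) (hK : 2 ≤ K)
    (hε : 0 < ε₀) (hν : ∀ k, IsProbabilityMeasure (ν k)) (hsub : ∀ k, IsOneSubGaussian (ν k))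
    {n : ℕ} (hn : 5 * (K : ℝ) ^ 2 / 2 < n) :
    ∫ ω, (bestMean (armMean ν) - armMean ν (B n ω)) ∂P ≤
      (K : ℝ) ^ 2 * Real.exp 2 * (2 + Real.log n) ^ 2 *
        ∑ i ∈ Finset.Icc 1 (numClasses (armMean ν) - 1),
          (gap (armMean ν) (i + 1) - gap (armMean ν) i) * Real.exp (-pFun
            (max 1 ((n - 5 * (K : ℝ) ^ 2 / 2) / (8 * complexity (armMean ν) ε₀ i)))) := by
  set μ := armMean ν with hμ
  have hKn := lt_of_five_mul_sq_lt hK hn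
  obtain ⟨q, rfl⟩ := Nat.exists_eq_succ_of_ne_zero (by omega : n ≠ 0)
  have hB : Measurable (B (q + 1)) := (h.measurable_leader q).mono (𝓕.le q) le_rfl
  have hset : ∀ i, MeasurableSet {ω | gap μ (i + 1) ≤ bestMean μ - μ (B (q + 1) ω)} := fun i =>
    hB (Set.toFinite {k | gap μ (i + 1) ≤ bestMean μ - μ k}).measurableSet
  have e : ∀ ω, bestMean μ - μ (B (q + 1) ω) = ∑ i ∈ Finset.Icc 1 (numClasses μ - 1),
      (gap μ (i + 1) - gap μ i) *
        {ω | gap μ (i + 1) ≤ bestMean μ - μ (B (q + 1) ω)}.indicator 1 ω := by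
    intro ω
    rw [regret_eq_sum μ (by omega)]
    simp only [Set.indicator_apply, Set.mem_ofPred_eq, Pi.one_apply]
  simp only [Nat.succ_eq_add_one] at hn ⊢
  rw [integral_congr_ae (Filter.Eventually.of_forall e), integral_finsetSum, Finset.mul_sum]
  · refine Finset.sum_le_sum fun i hi => ?_
    rw [Finset.mem_Icc] at hi
    have hi2 : i + 1 ≤ numClasses μ := by omega
    rw [integral_const_mul, integral_indicator_one (hset i), mul_left_comm]
    refine mul_le_mul_of_nonneg_left
      (h.measureReal_gap_le hK hε hν hsub hn hi.1 hi2) ?_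
    exact sub_nonneg.2 (gap_le_gap μ hi.1 (by omega) (by omega))
  · intro i _
    exact ((integrable_const 1).indicator (hset i)).const_mul _

end Regret

end EBTC

theorem corollary1 {K : ℕ} (hK : 2 ≤ K) {ε₀ : ℝ} (hε₀ : 0 < ε₀)
    (ν : Fin K → Measure ℝ) (hν : ∀ k, IsProbabilityMeasure (ν k))
    (hsub : ∀ k, EBTC.IsOneSubGaussian (ν k))
    (μ : Fin K → ℝ) (hμ : μ = EBTC.armMean ν)
    {Ω : Type*} [mΩ : MeasurableSpace Ω] (P : Measure Ω) [IsProbabilityMeasure P]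
    (𝓕 : Filtration ℕ mΩ)
    (I : ℕ → Ω → Fin K) (X : ℕ → Ω → ℝ) (B C : ℕ → Ω → Fin K)
    (hrun : EBTC.IsEBTC P ν ε₀ (1 / 2) 𝓕 I X B C) :
    -- the complexities
    (2 ≤ EBTC.numClasses μ →
      EBTC.complexity μ ε₀ 1 = K * (2 / EBTC.gap μ 2 + 3 / ε₀) ^ 2) ∧
    (∀ i ∈ Finset.Icc 2 (EBTC.numClasses μ - 1),
      2 * K / EBTC.gap μ (i + 1) ^ 2 ≤ EBTC.complexity μ ε₀ i ∧
      ∀ j ∈ Finset.Icc 1 i, EBTC.complexity μ ε₀ i ≤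
        3 / 2 * (K * (max (2 / EBTC.gap μ (j + 1))
          (2 * ((EBTC.gap μ j / ε₀ + 1) / (EBTC.gap μ (i + 1) - EBTC.gap μ j))
            + 3 / ε₀)) ^ 2)) ∧
    -- the bound on the expected simple regret
    (∀ n : ℕ, 5 * (K : ℝ) ^ 2 / 2 < n →
      ∫ ω, (EBTC.bestMean μ - μ (B n ω)) ∂P ≤
        (K : ℝ) ^ 2 * Real.exp 2 * (2 + Real.log n) ^ 2 *
          ∑ i ∈ Finset.Icc 1 (EBTC.numClasses μ - 1),
            (EBTC.gap μ (i + 1) - EBTC.gap μ i) *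
              Real.exp (-EBTC.pFun
                (max 1 ((n - 5 * (K : ℝ) ^ 2 / 2) / (8 * EBTC.complexity μ ε₀ i))))) ∧
    (∀ n : ℕ, 5 * (K : ℝ) ^ 2 / 2 < n →
      (∀ i ∈ Finset.Icc 1 (EBTC.numClasses μ - 1),
        5 * (K : ℝ) ^ 2 / 2 + 8 * EBTC.complexity μ ε₀ i ≤ n) →
      ∫ ω, (EBTC.bestMean μ - μ (B n ω)) ∂P ≤
        (K : ℝ) ^ 2 * Real.exp 2 * (2 + Real.log n) ^ 2 *
          ∑ i ∈ Finset.Icc 1 (EBTC.numClasses μ - 1),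
            (EBTC.gap μ (i + 1) - EBTC.gap μ i) *
              Real.exp (-EBTC.pFun
                ((n - 5 * (K : ℝ) ^ 2 / 2) / (8 * EBTC.complexity μ ε₀ i)))) := by
  subst hμ
  have hK0 : 0 < K := by omega
  refine ⟨fun hC => EBTC.complexity_one _ hK0 hε₀ hC, fun i hi => ?_, fun n hn =>
    hrun.integral_regret_le hK hε₀ hν hsub hn, fun n hn hH => ?_⟩
  · rw [Finset.mem_Icc] at hi
    exact ⟨EBTC.le_complexity _ hK0 hε₀ (by omega) (by omega), fun j hj =>
      EBTC.complexity_le_mul _ hK0 hε₀ hj (by omega)⟩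
  · refine (hrun.integral_regret_le hK hε₀ hν hsub hn).trans (le_of_eq ?_)
    congr 1
    refine Finset.sum_congr rfl fun i hi => ?_
    have hi' := Finset.mem_Icc.1 hi
    have hpos := EBTC.complexity_pos (EBTC.armMean ν) hK0 hε₀ hi'.1 (by omega)
    -- The extra assumption on `n` says exactly that each ratio is at least 1, so the truncation
    -- disappears.
    rw [max_eq_right]
    rw [le_div_iff₀ (by positivity)]
    linarith [hH i hi]
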